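/- Let $(X,d)$ be a compact metric space, $T:X\to X$ a homeomorphism, and $K\subset X$ a non-empty compact set. Let $M(X)$ be the set of Borel probability measures on $X$. For $n\in\mathbb N$ put $d_n(x,y)=\max_{0\le j\le n-1}d(T^jx,T^jy)$, $B_n(x,\epsilon)=\{y: d_n(x,y)<\epsilon\}$ and $\overline B_n(x,\epsilon)=\{y: d_n(x,y)\le\epsilon\}$. For $Z\subset X$, $\epsilon>0$, $s\ge 0$, $N\in\mathbb N$, let $$M(Z,s,N,\epsilon)=\inf\sum_{i\in I}e^{-n_is},$$ the infimum over all finite or countable families with $Z\subset\bigcup_{i\in I}B_{n_i}(x_i,\epsilon)$, $n_i\ge N$, $x_i\in X$; let $M(Z,s,\epsilon)=\lim_{N\to\infty}M(Z,s,N,\epsilon)$ and $h^B_{top}(T,Z,d,\epsilon)=\inf\{s\ge0: M(Z,s,\epsilon)=0\}$. Let $$P(Z,s,N,\epsilon)=\sup\sum_{i\in I}e^{-n_is},$$ the supremum over all finite or countable pairwise disjoint families $\{\overline B_{n_i}(x_i,\epsilon)\}_{i\in I}$ with $n_i\ge N$, $x_i\in Z$; let $P(Z,s,\epsilon)=\lim_{N\to\infty}P(Z,s,N,\epsilon)$,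 $\mathcal P(Z,s,\epsilon)=\inf\{\sum_{i\ge1}P(Z_i,s,\epsilon): Z\subset\bigcup_{i\ge1}Z_i\}$ and $h^P_{top}(T,Z,d,\epsilon)=\inf\{s\ge0:\mathcal P(Z,s,\epsilon)=0\}$. The Bowen and packing upper metric mean dimensions of $Z$ are $$\overline{\mathrm{mdim}}{}_M^B(T,Z,d)=\limsup_{\epsilon\to0}\frac{h^B_{top}(T,Z,d,\epsilon)}{\log\frac1\epsilon},\qquad \overline{\mathrm{mdim}}{}_M^P(T,Z,d)=\limsup_{\epsilon\to0}\frac{h^P_{top}(T,Z,d,\epsilon)}{\log\frac1\epsilon}.$$ For $\mu\in M(X)$ and $\delta\in(0,1)$ let $M^\delta(\mu,s,N,\epsilon)=\inf\sum_{i\in I}e^{-n_is}$, the infimum over all finite or countable families with $\mu(\bigcup_{i\in I}B_{n_i}(x_i,\epsilon))>1-\delta$, $n_i\ge N$, $x_i\in X$; let $M^\delta(\mu,s,\epsilon)=\lim_{N\to\infty}M^\delta(\mu,s,N,\epsilon)$, and $$M_\mu(T,d,\epsilon)=\lim_{\delta\to0}\inf\{s\ge0:M^\delta(\mu,s,\epsilon)=0\}.$$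 Let $\mathcal P^\delta(\mu,s,\epsilon)=\inf\{\sum_{i\ge1}P(Z_i,s,\epsilon):\mu(\bigcup_{i\ge1}Z_i)>1-\delta\}$, where the $Z_i$ are arbitrary subsets of $X$ and $\mu$ denotes the outer measure on non-measurable sets, and $$\mathcal P_\mu(T,d,\epsilon)=\lim_{\delta\to0}\inf\{s\ge0:\mathcal P^\delta(\mu,s,\epsilon)=0\}.$$ Then, with both sides of each equality in $[0,\infty]$, $$\overline{\mathrm{mdim}}{}_M^B(T,K,d)=\limsup_{\epsilon\to0}\frac1{\log\frac1\epsilon}\sup\{M_\mu(T,d,\epsilon):\mu\in M(X),\ \mu(K)=1\},$$ $$\overline{\mathrm{mdim}}{}_M^P(T,K,d)=\limsup_{\epsilon\to0}\frac1{\log\frac1\epsilon}\sup\{\mathcal P_\mu(T,d,\epsilon):\mu\in M(X),\ \mu(K)=1\}.$$ -/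

import Mathlib

open Set Filter Topology MeasureTheory
open scoped NNReal ENNReal

namespace MetricMeanDim

section Metric

variable {X : Type*} [MetricSpace X]

/-- The `n`-th Bowen metric `d_n(x, y) = max_{0 ≤ j ≤ n - 1} d(T^j x, T^j y)`
(equal to `0` for `n = 0`). -/
noncomputable def bowenDist (T : X → X) (n : ℕ) (x y : X) : ℝ :=
  ⨆ j : Fin n, dist (T^[j] x) (T^[j] y)

/-- The open Bowen ball `B_n(x, ε)`. -/
def bowenBall (T : X → X) (n : ℕ) (x : X) (ε : ℝ) : Set X :=
  {y | bowenDist T n x y < ε}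

/-- The closed Bowen ball of order `n` and radius `ε` around `x`. -/
def bowenClosedBall (T : X → X) (n : ℕ) (x : X) (ε : ℝ) : Set X :=
  {y | bowenDist T n x y ≤ ε}

/-- The sum `∑_{i ∈ I} e^{-n_i s}` of a family of pairs `(n_i, x_i)`, given as a set of pairs. -/
noncomputable def weight (s : ℝ≥0) (I : Set (ℕ × X)) : ℝ≥0∞ :=
  ∑' i : I, ENNReal.ofReal (Real.exp (-((i.1.1 : ℝ) * s)))

/-- The union `⋃_{i ∈ I} B_{n_i}(x_i, ε)`. -/
def ballUnion (T : X → X) (ε : ℝ) (I : Set (ℕ × X)) : Set X :=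
  ⋃ i ∈ I, bowenBall T i.1 i.2 ε

/-! ### Bowen metric mean dimension -/

/-- `M(T, d, Z, s, N, ε)`: infimum over finite or countable covers of `Z` by open Bowen balls
of orders at least `N`. -/
noncomputable def bowenMN (T : X → X) (Z : Set X) (s : ℝ≥0) (N : ℕ) (ε : ℝ) : ℝ≥0∞ :=
  ⨅ (I : Set (ℕ × X)) (_ : I.Countable) (_ : ∀ i ∈ I, N ≤ i.1) (_ : Z ⊆ ballUnion T ε I),
    weight s I

/-- `M(T, d, Z, s, ε)`, the limit of `M(T, d, Z, s, N, ε)` as `N → ∞`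
(a supremum, by monotonicity; see `tendsto_bowenMN`). -/
noncomputable def bowenM (T : X → X) (Z : Set X) (s : ℝ≥0) (ε : ℝ) : ℝ≥0∞ :=
  ⨆ N : ℕ, bowenMN T Z s N ε

/-- The Bowen `ε`-entropy `h_top^B(T, Z, d, ε)`. -/
noncomputable def bowenEntropy (T : X → X) (Z : Set X) (ε : ℝ) : ℝ≥0∞ :=
  ⨅ (s : ℝ≥0) (_ : bowenM T Z s ε = 0), (s : ℝ≥0∞)

/-- The Bowen upper metric mean dimension of `Z`. -/
noncomputable def bowenUpperMdim (T : X → X) (Z : Set X) : ℝ≥0∞ :=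
  limsup (fun ε : ℝ => bowenEntropy T Z ε / ENNReal.ofReal (Real.log (1 / ε))) (𝓝[>] 0)

/-! ### Packing metric mean dimension -/

/-- `P(T, d, Z, s, N, ε)`: supremum over finite or countable pairwise disjoint families of closed
Bowen balls of orders at least `N` with centres in `Z`. -/
noncomputable def packPN (T : X → X) (Z : Set X) (s : ℝ≥0) (N : ℕ) (ε : ℝ) : ℝ≥0∞ :=
  ⨆ (I : Set (ℕ × X)) (_ : I.Countable) (_ : ∀ i ∈ I, N ≤ i.1 ∧ i.2 ∈ Z)
    (_ : I.PairwiseDisjoint fun i => bowenClosedBall T i.1 i.2 ε), weight s I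

/-- `P(T, d, Z, s, ε)`, the limit of `P(T, d, Z, s, N, ε)` as `N → ∞`
(an infimum, by monotonicity; see `tendsto_packPN`). -/
noncomputable def packP (T : X → X) (Z : Set X) (s : ℝ≥0) (ε : ℝ) : ℝ≥0∞ :=
  ⨅ N : ℕ, packPN T Z s N ε

/-- `𝒫(T, d, Z, s, ε)`: infimum of `∑ P(T, d, Z_i, s, ε)` over countable covers of `Z`. -/
noncomputable def packOuter (T : X → X) (Z : Set X) (s : ℝ≥0) (ε : ℝ) : ℝ≥0∞ :=
  ⨅ (W : ℕ → Set X) (_ : Z ⊆ ⋃ i, W i), ∑' i, packP T (W i) s ε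

/-- The packing `ε`-entropy `h_top^P(T, Z, d, ε)`. -/
noncomputable def packEntropy (T : X → X) (Z : Set X) (ε : ℝ) : ℝ≥0∞ :=
  ⨅ (s : ℝ≥0) (_ : packOuter T Z s ε = 0), (s : ℝ≥0∞)

/-- The packing upper metric mean dimension of `Z`. -/
noncomputable def packUpperMdim (T : X → X) (Z : Set X) : ℝ≥0∞ :=
  limsup (fun ε : ℝ => packEntropy T Z ε / ENNReal.ofReal (Real.log (1 / ε))) (𝓝[>] 0)

end Metric

/-! ### Bowen and packing Katok entropy-like `ε`-entropies of a measure -/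

section Measure

variable {X : Type*} [MetricSpace X] [MeasurableSpace X]

/-- `M^δ(T, d, μ, s, N, ε)`: infimum over finite or countable families of open Bowen balls of
orders at least `N` whose union has measure greater than `1 - δ`. -/
noncomputable def katokMN (T : X → X) (μ : Measure X) (δ : ℝ) (s : ℝ≥0) (N : ℕ) (ε : ℝ) : ℝ≥0∞ :=
  ⨅ (I : Set (ℕ × X)) (_ : I.Countable) (_ : ∀ i ∈ I, N ≤ i.1)
    (_ : ENNReal.ofReal (1 - δ) < μ (ballUnion T ε I)), weight s I

/-- `M^δ(T, d, μ, s, ε)`, the limit of `M^δ(T, d, μ, s, N, ε)` as `N → ∞`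
(a supremum, by monotonicity; see `tendsto_katokMN`). -/
noncomputable def katokM (T : X → X) (μ : Measure X) (δ : ℝ) (s : ℝ≥0) (ε : ℝ) : ℝ≥0∞ :=
  ⨆ N : ℕ, katokMN T μ δ s N ε

/-- The critical value `M^δ(T, d, μ, ε)`. -/
noncomputable def katokEntropyDelta (T : X → X) (μ : Measure X) (δ ε : ℝ) : ℝ≥0∞ :=
  ⨅ (s : ℝ≥0) (_ : katokM T μ δ s ε = 0), (s : ℝ≥0∞)

/-- `M_μ(T, d, ε)`, the limit of `M^δ(T, d, μ, ε)` as `δ → 0`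
(a supremum over `δ ∈ (0, 1)`, by monotonicity; see `tendsto_katokEntropyDelta`). -/
noncomputable def katokEntropy (T : X → X) (μ : Measure X) (ε : ℝ) : ℝ≥0∞ :=
  ⨆ δ ∈ Ioo (0 : ℝ) 1, katokEntropyDelta T μ δ ε

/-- `𝒫^δ(T, d, μ, s, ε)`: infimum of `∑ P(T, d, Z_i, s, ε)` over sequences of subsets whose union
has measure greater than `1 - δ` (outer measure, if the union is not measurable). -/
noncomputable def packKatokP (T : X → X) (μ : Measure X) (δ : ℝ) (s : ℝ≥0) (ε : ℝ) : ℝ≥0∞ :=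
  ⨅ (W : ℕ → Set X) (_ : ENNReal.ofReal (1 - δ) < μ (⋃ i, W i)), ∑' i, packP T (W i) s ε

/-- The critical value `𝒫^δ(T, d, μ, ε)`. -/
noncomputable def packKatokEntropyDelta (T : X → X) (μ : Measure X) (δ ε : ℝ) : ℝ≥0∞ :=
  ⨅ (s : ℝ≥0) (_ : packKatokP T μ δ s ε = 0), (s : ℝ≥0∞)

/-- `𝒫_μ(T, d, ε)`, the limit of `𝒫^δ(T, d, μ, ε)` as `δ → 0`
(a supremum over `δ ∈ (0, 1)`, by monotonicity; see `tendsto_packKatokEntropyDelta`). -/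
noncomputable def packKatokEntropy (T : X → X) (μ : Measure X) (ε : ℝ) : ℝ≥0∞ :=
  ⨆ δ ∈ Ioo (0 : ℝ) 1, packKatokEntropyDelta T μ δ ε

end Measure

/-! ### The suprema and infima above are the limits they stand for -/

section Limits

variable {X : Type*} [MetricSpace X]

theorem tendsto_bowenMN (T : X → X) (Z : Set X) (s : ℝ≥0) (ε : ℝ) :
    Tendsto (fun N => bowenMN T Z s N ε) atTop (𝓝 (bowenM T Z s ε)) := by
  refine tendsto_atTop_iSup fun N N' h => ?_
  refine le_iInf fun I => le_iInf fun hc => le_iInf fun hN => le_iInf fun hZ => ?_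
  exact iInf_le_of_le I (iInf_le_of_le hc (iInf_le_of_le (fun i hi => h.trans (hN i hi))
    (iInf_le_of_le hZ le_rfl)))

theorem tendsto_packPN (T : X → X) (Z : Set X) (s : ℝ≥0) (ε : ℝ) :
    Tendsto (fun N => packPN T Z s N ε) atTop (𝓝 (packP T Z s ε)) := by
  refine tendsto_atTop_iInf fun N N' h => ?_
  refine iSup_le fun I => iSup_le fun hc => iSup_le fun hN => iSup_le fun hZ => ?_
  exact le_iSup_of_le I (le_iSup_of_le hc (le_iSup_of_le
    (fun i hi => ⟨h.trans (hN i hi).1, (hN i hi).2⟩) (le_iSup_of_le hZ le_rfl)))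

variable [MeasurableSpace X]

theorem tendsto_katokMN (T : X → X) (μ : Measure X) (δ : ℝ) (s : ℝ≥0) (ε : ℝ) :
    Tendsto (fun N => katokMN T μ δ s N ε) atTop (𝓝 (katokM T μ δ s ε)) := by
  refine tendsto_atTop_iSup fun N N' h => ?_
  refine le_iInf fun I => le_iInf fun hc => le_iInf fun hN => le_iInf fun hZ => ?_
  exact iInf_le_of_le I (iInf_le_of_le hc (iInf_le_of_le (fun i hi => h.trans (hN i hi))
    (iInf_le_of_le hZ le_rfl)))

theorem tendsto_of_antitone_zero {f : ℝ → ℝ≥0∞} (hf : Antitone f) :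
    Tendsto f (𝓝[>] 0) (𝓝 (⨆ δ ∈ Ioo (0 : ℝ) 1, f δ)) := by
  refine tendsto_order.2 ⟨fun a ha => ?_, fun a ha => ?_⟩
  · obtain ⟨δ, h⟩ := lt_iSup_iff.1 ha
    obtain ⟨hδ, h⟩ := lt_iSup_iff.1 h
    filter_upwards [Ioo_mem_nhdsGT hδ.1] with x hx
    exact h.trans_le (hf hx.2.le)
  · filter_upwards [Ioo_mem_nhdsGT (zero_lt_one' ℝ)] with x hx
    exact (le_iSup₂ (f := fun δ (_ : δ ∈ Ioo (0 : ℝ) 1) => f δ) x hx).trans_lt ha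

theorem tendsto_katokEntropyDelta (T : X → X) (μ : Measure X) (ε : ℝ) :
    Tendsto (fun δ => katokEntropyDelta T μ δ ε) (𝓝[>] 0) (𝓝 (katokEntropy T μ ε)) := by
  refine tendsto_of_antitone_zero fun δ δ' h => ?_
  refine le_iInf fun s => le_iInf fun hs => iInf_le_of_le s (iInf_le_of_le ?_ le_rfl)
  refine le_antisymm (le_trans (iSup_mono fun N => ?_) hs.le) bot_le
  refine le_iInf fun I => le_iInf fun hc => le_iInf fun hN => le_iInf fun hZ => ?_
  exact iInf_le_of_le I (iInf_le_of_le hc (iInf_le_of_le hN (iInf_le_of_le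
    ((ENNReal.ofReal_le_ofReal (by linarith)).trans_lt hZ) le_rfl)))

theorem tendsto_packKatokEntropyDelta (T : X → X) (μ : Measure X) (ε : ℝ) :
    Tendsto (fun δ => packKatokEntropyDelta T μ δ ε) (𝓝[>] 0) (𝓝 (packKatokEntropy T μ ε)) := by
  refine tendsto_of_antitone_zero fun δ δ' h => ?_
  refine le_iInf fun s => le_iInf fun hs => iInf_le_of_le s (iInf_le_of_le ?_ le_rfl)
  refine le_antisymm (le_trans ?_ hs.le) bot_le
  refine le_iInf fun W => le_iInf fun hW => ?_
  exact iInf_le_of_le W (iInf_le_of_le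
    ((ENNReal.ofReal_le_ofReal (by linarith)).trans_lt hW) le_rfl)

end Limits

end MetricMeanDim

/-!
For each scale `ε` the measure-theoretic entropies of the measures on `K` are at most the
topological entropy of `K`, because a cover of `K` has full measure for all of them. Conversely,
up to replacing `ε` by `2 * ε` or `4 * ε`, which does not affect an upper limit normalised by
`log (1 / ε)` (`limsup_div_log_le`), every `s` below the topological entropy is a lower bound for
the entropy of some measure on `K`, constructed from the positivity of an outer measure of `K`.

* Bowen case. Positivity of the outer measure for some `t > s` bounds below the cost
  `∑ c_i e^{-n_i s}` of the finite weighted covers of `K` by Bowen balls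
  (`bowenMN_le_of_weighted_cover`): the set where the balls of order `n` have multiplicity more than
  `τ` is covered by at most `(∑ c_i) / τ` balls of twice the radius, and thresholds decaying like
  `e^{-n(t-s)}` can be used on the successive levels `n`. The minimal cost of a weighted cover is a
  sublinear functional on continuous functions, so the Hahn–Banach and Riesz–Markov–Kakutani
  theorems give a measure with `μ (B_n(x, ε)) ≤ C e^{-ns}` (`exists_measure_le_cost`,
  `exists_frostman_measure`), and the mass distribution principle applies.
* Packing case. After removal of the relatively open null sets from `K`, a pigeonhole argument
  provides in every relatively open subset of `K`, for arbitrarily large `n`, at least `e^{ns}`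
  points that are separated for `d_n` (`exists_separated_of_packP_ne_zero`). Mass is distributed
  equally over small neighbourhoods of such points, and again inside each of these neighbourhoods
  with a larger order, and so on (`MassScheme.exists_refinement`). By compactness some probability
  measure is compatible with all stages; almost every point has closed Bowen balls of arbitrarily
  large order `n` with mass at most `e^{-ns}` (`exists_measure_small_balls`), and a Vitali covering
  argument turns this into a lower bound for packing sums (`measure_inter_le_packP`).
-/

namespace MetricMeanDim

/-! ### Bowen metrics -/

section BowenMetric

variable {X : Type*} [MetricSpace X] {T : X → X}

theorem bowenDist_le_iff {n : ℕ} {x y : X} {r : ℝ} (hr : 0 ≤ r) :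
    bowenDist T n x y ≤ r ↔ ∀ j < n, dist (T^[j] x) (T^[j] y) ≤ r := by
  constructor
  · intro h j hj
    exact (le_ciSup (f := fun j : Fin n => dist (T^[j] x) (T^[j] y))
      (finite_range _).bddAbove ⟨j, hj⟩).trans h
  · intro h
    exact Real.iSup_le (fun j => h j j.2) hr

theorem bowenDist_nonneg (n : ℕ) (x y : X) : 0 ≤ bowenDist T n x y :=
  Real.iSup_nonneg fun _ => dist_nonneg

theorem dist_iterate_le_bowenDist {n j : ℕ} (hj : j < n) (x y : X) :
    dist (T^[j] x) (T^[j] y) ≤ bowenDist T n x y :=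
  (bowenDist_le_iff (bowenDist_nonneg n x y)).1 le_rfl j hj

theorem bowenDist_lt_iff {n : ℕ} {x y : X} {r : ℝ} (hr : 0 < r) :
    bowenDist T n x y < r ↔ ∀ j < n, dist (T^[j] x) (T^[j] y) < r := by
  refine ⟨fun h j hj => (dist_iterate_le_bowenDist hj x y).trans_lt h, fun h => ?_⟩
  rcases n.eq_zero_or_pos with rfl | hn
  · exact ((bowenDist_le_iff le_rfl).2 (by simp)).trans_lt hr
  · have : Nonempty (Fin n) := ⟨⟨0, hn⟩⟩
    obtain ⟨j, hj⟩ := exists_eq_ciSup_of_finite (f := fun j : Fin n => dist (T^[j] x) (T^[j] y))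
    exact hj.symm.trans_lt (h j j.2)

@[simp]
theorem bowenDist_self (n : ℕ) (x : X) : bowenDist T n x x = 0 :=
  le_antisymm ((bowenDist_le_iff le_rfl).2 (by simp)) (bowenDist_nonneg n x x)

theorem bowenDist_comm (n : ℕ) (x y : X) : bowenDist T n x y = bowenDist T n y x := by
  simp only [bowenDist, dist_comm]

theorem bowenDist_triangle (n : ℕ) (x y z : X) :
    bowenDist T n x z ≤ bowenDist T n x y + bowenDist T n y z :=
  (bowenDist_le_iff (add_nonneg (bowenDist_nonneg ..) (bowenDist_nonneg ..))).2 fun _ hj =>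
    (dist_triangle _ _ _).trans
      (add_le_add (dist_iterate_le_bowenDist hj x y) (dist_iterate_le_bowenDist hj y z))

theorem bowenDist_mono {m n : ℕ} (h : m ≤ n) (x y : X) : bowenDist T m x y ≤ bowenDist T n x y :=
  (bowenDist_le_iff (bowenDist_nonneg ..)).2 fun _ hj =>
    dist_iterate_le_bowenDist (hj.trans_le h) x y

theorem mem_bowenBall {n : ℕ} {x y : X} {ε : ℝ} :
    y ∈ bowenBall T n x ε ↔ bowenDist T n x y < ε := Iff.rfl

theorem mem_bowenClosedBall {n : ℕ} {x y : X} {ε : ℝ} :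
    y ∈ bowenClosedBall T n x ε ↔ bowenDist T n x y ≤ ε := Iff.rfl

theorem mem_bowenBall_self {n : ℕ} {x : X} {ε : ℝ} (hε : 0 < ε) : x ∈ bowenBall T n x ε := by
  simpa [mem_bowenBall]

theorem bowenBall_subset_bowenClosedBall {n : ℕ} {x : X} {ε : ℝ} :
    bowenBall T n x ε ⊆ bowenClosedBall T n x ε := fun _ h => le_of_lt (mem_bowenBall.1 h)

theorem isOpen_bowenBall (hT : Continuous T) {n : ℕ} {x : X} {ε : ℝ} (hε : 0 < ε) :
    IsOpen (bowenBall T n x ε) := by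
  have : bowenBall T n x ε = ⋂ j ∈ Finset.range n, {y | dist (T^[j] x) (T^[j] y) < ε} := by
    ext y
    simp [mem_bowenBall, bowenDist_lt_iff hε]
  rw [this]
  exact isOpen_biInter_finset fun j _ =>
    isOpen_lt (continuous_const.dist (hT.iterate j)) continuous_const

/-- Each ball of a disjoint family contains a nonempty open set, and the space is separable. -/
theorem countable_of_pairwiseDisjoint_bowenClosedBall [CompactSpace X] (hT : Continuous T)
    {ε : ℝ} (hε : 0 < ε) {I : Set (ℕ × X)}
    (hI : I.PairwiseDisjoint fun i => bowenClosedBall T i.1 i.2 ε) : I.Countable := by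
  have hI' : I.PairwiseDisjoint fun i => bowenBall T i.1 i.2 ε :=
    hI.mono fun _ => bowenBall_subset_bowenClosedBall
  exact hI'.countable_of_isOpen (fun _ _ => isOpen_bowenBall hT hε)
    fun i _ => ⟨i.2, mem_bowenBall_self hε⟩

end BowenMetric

/-! ### Monotonicity of the outer quantities, and the bounds by the topological entropies -/

section Monotone

theorem weight_anti {X : Type*} (I : Set (ℕ × X)) : Antitone fun s => weight s I := fun s t h => by
  refine ENNReal.tsum_le_tsum fun i => ENNReal.ofReal_le_ofReal (Real.exp_le_exp.2 ?_)
  have : (s : ℝ) ≤ t := h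
  gcongr

theorem ofReal_one_sub_lt_of_subset {X : Type*} [MeasurableSpace X] {μ : Measure X}
    {K U : Set X} (hμ : μ K = 1) {δ : ℝ}
    (hδ : δ ∈ Ioo (0 : ℝ) 1) (h : K ⊆ U) : ENNReal.ofReal (1 - δ) < μ U := by
  refine lt_of_lt_of_le ?_ (hμ.symm.le.trans (measure_mono h))
  rw [← ENNReal.ofReal_one]
  exact (ENNReal.ofReal_lt_ofReal_iff one_pos).2 (by linarith [hδ.1])

variable {X : Type*} [MetricSpace X] {T : X → X}

theorem packP_anti (W : Set X) (ε : ℝ) : Antitone fun s => packP T W s ε := fun _ _ h =>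
  iInf_mono fun _ => iSup_mono fun I => iSup_mono fun _ => iSup_mono fun _ => iSup_mono fun _ =>
    weight_anti I h

/-- If a family of quantities decreasing in `s` does not vanish at `s`, its critical exponent is at
least `s`. -/
theorem le_iInf_of_ne_zero {f : ℝ≥0 → ℝ≥0∞} (hf : Antitone f) {s : ℝ≥0} (hs : f s ≠ 0) :
    (s : ℝ≥0∞) ≤ ⨅ (t : ℝ≥0) (_ : f t = 0), (t : ℝ≥0∞) := by
  refine le_iInf₂ fun t ht => ENNReal.coe_le_coe.2 (not_lt.1 fun h => hs ?_)
  exact le_antisymm ((hf h.le).trans ht.le) bot_le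

/-- Below its critical exponent a family of quantities does not vanish. -/
theorem ne_zero_of_lt_iInf {f : ℝ≥0 → ℝ≥0∞} {s : ℝ≥0}
    (h : (s : ℝ≥0∞) < ⨅ (t : ℝ≥0) (_ : f t = 0), (t : ℝ≥0∞)) : f s ≠ 0 := fun h0 =>
  (h.trans_le (iInf₂_le s h0)).false

theorem packP_empty (s : ℝ≥0) (ε : ℝ) : packP T ∅ s ε = 0 := by
  refine le_antisymm (iInf_le_of_le 0 ?_) bot_le
  refine iSup_le fun I => iSup_le fun _ => iSup_le fun hI => iSup_le fun _ => ?_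
  have : I = ∅ := eq_empty_of_forall_notMem fun i hi => (hI i hi).2
  subst this
  simp [weight]

theorem packOuter_le_packP (Z : Set X) (s : ℝ≥0) (ε : ℝ) :
    packOuter T Z s ε ≤ packP T Z s ε := by
  refine iInf₂_le_of_le (fun i : ℕ => if i = 0 then Z else ∅)
    (fun x hx => mem_iUnion.2 ⟨0, by simpa⟩) ?_
  rw [tsum_eq_single 0 fun i hi => by simp [hi, packP_empty]]
  simp

theorem packOuter_mono {Z Z' : Set X} (h : Z ⊆ Z') (s : ℝ≥0) (ε : ℝ) :
    packOuter T Z s ε ≤ packOuter T Z' s ε :=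
  iInf_mono fun _ => iInf_mono' fun h' => ⟨h.trans h', le_rfl⟩

theorem packOuter_iUnion_le (Z : ℕ → Set X) (s : ℝ≥0) (ε : ℝ) :
    packOuter T (⋃ i, Z i) s ε ≤ ∑' i, packOuter T (Z i) s ε := by
  refine ENNReal.le_of_forall_pos_le_add fun η hη htop => ?_
  obtain ⟨η', hη', hsum⟩ := ENNReal.exists_pos_sum_of_countable (ENNReal.coe_pos.2 hη).ne' ℕ
  have hne : ∀ i, packOuter T (Z i) s ε ≠ ⊤ := ENNReal.ne_top_of_tsum_ne_top htop.ne
  have (i : ℕ) : ∃ W : ℕ → Set X, Z i ⊆ ⋃ k, W k ∧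
      ∑' k, packP T (W k) s ε < packOuter T (Z i) s ε + η' i := by
    have := ENNReal.lt_add_right (hne i) (ENNReal.coe_pos.2 (hη' i)).ne'
    simpa only [packOuter, iInf_lt_iff, exists_prop] using this
  choose W hW hlt using this
  let e := Nat.pairEquiv.symm
  refine iInf₂_le_of_le (fun m => W (e m).1 (e m).2) ?_ ?_
  · refine iUnion_subset fun i x hx => ?_
    obtain ⟨k, hk⟩ := mem_iUnion.1 (hW i hx)
    exact mem_iUnion.2 ⟨e.symm (i, k), by simpa using hk⟩
  · rw [e.tsum_eq (fun p : ℕ × ℕ => packP T (W p.1 p.2) s ε),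
      ENNReal.tsum_prod (f := fun i k => packP T (W i k) s ε)]
    calc _ ≤ ∑' i, (packOuter T (Z i) s ε + η' i) := ENNReal.tsum_le_tsum fun i => (hlt i).le
      _ ≤ _ := by rw [ENNReal.tsum_add]; gcongr

variable [MeasurableSpace X]

theorem katokM_anti (μ : Measure X) (δ ε : ℝ) : Antitone fun s => katokM T μ δ s ε :=
  fun _ _ h => iSup_mono fun _ => iInf_mono fun I => iInf_mono fun _ => iInf_mono fun _ =>
    iInf_mono fun _ => weight_anti I h

theorem packKatokP_anti (μ : Measure X) (δ ε : ℝ) : Antitone fun s => packKatokP T μ δ s ε :=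
  fun _ _ h => iInf_mono fun W => iInf_mono fun _ => ENNReal.tsum_le_tsum fun i =>
    packP_anti (W i) ε h

/-- A cover of `K` carries the full mass of every measure concentrated on `K`. -/
theorem katokEntropy_le_bowenEntropy {μ : Measure X} {K : Set X} (hμ : μ K = 1) (ε : ℝ) :
    katokEntropy T μ ε ≤ bowenEntropy T K ε := by
  refine iSup₂_le fun δ hδ => le_iInf₂ fun s hs => iInf₂_le_of_le s ?_ le_rfl
  refine le_antisymm (le_trans (iSup_mono fun N => ?_) hs.le) bot_le
  exact iInf_mono fun I => iInf_mono fun _ => iInf_mono fun _ => iInf_mono' fun h =>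
    ⟨ofReal_one_sub_lt_of_subset hμ hδ h, le_rfl⟩

theorem packKatokEntropy_le_packEntropy {μ : Measure X} {K : Set X} (hμ : μ K = 1) (ε : ℝ) :
    packKatokEntropy T μ ε ≤ packEntropy T K ε := by
  refine iSup₂_le fun δ hδ => le_iInf₂ fun s hs => iInf₂_le_of_le s ?_ le_rfl
  refine le_antisymm (le_trans ?_ hs.le) bot_le
  exact iInf_mono fun I => iInf_mono' fun h => ⟨ofReal_one_sub_lt_of_subset hμ hδ h, le_rfl⟩

end Monotone

/-! ### Rescaling the radius -/

/-- Rescaling `ε` by a constant changes `log (1 / ε)` by a bounded amount, hence does not affect an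
upper limit normalised by `log (1 / ε)`. -/
theorem limsup_div_log_le {F G : ℝ → ℝ≥0∞} {c : ℝ} (hc : 0 < c)
    (h : ∀ ε > 0, F (c * ε) ≤ G ε) :
    limsup (fun ε : ℝ => F ε / ENNReal.ofReal (Real.log (1 / ε))) (𝓝[>] 0) ≤
      limsup (fun ε : ℝ => G ε / ENNReal.ofReal (Real.log (1 / ε))) (𝓝[>] 0) := by
  set g : ℝ → ℝ≥0∞ := fun ε => G ε / ENNReal.ofReal (Real.log (1 / ε)) with hg
  have hlim : Tendsto (fun ε : ℝ => ε / c) (𝓝[>] 0) (𝓝[>] 0) := by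
    refine tendsto_nhdsWithin_iff.2 ⟨?_, ?_⟩
    · have : Tendsto (fun ε : ℝ => ε / c) (𝓝 0) (𝓝 (0 / c)) := tendsto_id.div_const c
      rw [zero_div] at this
      exact this.mono_left nhdsWithin_le_nhds
    · filter_upwards [self_mem_nhdsWithin] with ε hε using div_pos hε hc
  have hlog : Tendsto (fun ε : ℝ => Real.log (1 / ε)) (𝓝[>] 0) atTop := by
    simp only [one_div]
    exact Real.tendsto_log_atTop.comp tendsto_inv_nhdsGT_zero
  -- any factor `a > 1` absorbs the bounded change of `log (1 / ε)`
  have key (a : ℝ) (ha : 1 < a) :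
      limsup (fun ε : ℝ => F ε / ENNReal.ofReal (Real.log (1 / ε))) (𝓝[>] 0) ≤
        ENNReal.ofReal a * limsup g (𝓝[>] 0) := by
    have hle : ∀ᶠ ε : ℝ in 𝓝[>] 0, F ε / ENNReal.ofReal (Real.log (1 / ε)) ≤
        ENNReal.ofReal a * g (ε / c) := by
      filter_upwards [self_mem_nhdsWithin, hlog.eventually_gt_atTop 0,
        hlog.eventually_ge_atTop (Real.log c / (a - 1)), (hlog.comp hlim).eventually_gt_atTop 0]
        with ε hε h1 h2 h3
      have hε : 0 < ε := hε
      have h4 : Real.log (1 / (ε / c)) = Real.log c + Real.log (1 / ε) := by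
        rw [← Real.log_mul hc.ne' (by positivity)]
        congr 1
        field_simp
      have h5 : Real.log (1 / (ε / c)) ≤ a * Real.log (1 / ε) := by
        rw [div_le_iff₀ (by linarith)] at h2
        rw [h4]; linarith
      have hF : F ε ≤ G (ε / c) := by
        have := h (ε / c) (div_pos hε hc)
        rwa [mul_div_cancel₀ _ hc.ne'] at this
      simp only [Function.comp] at h3
      rw [hg]
      refine ENNReal.div_le_of_le_mul ?_
      calc F ε ≤ G (ε / c) := hF
        _ = G (ε / c) / ENNReal.ofReal (Real.log (1 / (ε / c))) *
            ENNReal.ofReal (Real.log (1 / (ε / c))) :=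
          (ENNReal.div_mul_cancel (by simpa using h3) ENNReal.ofReal_ne_top).symm
        _ ≤ G (ε / c) / ENNReal.ofReal (Real.log (1 / (ε / c))) *
            ENNReal.ofReal (a * Real.log (1 / ε)) := by gcongr
        _ = _ := by rw [ENNReal.ofReal_mul (by linarith)]; ring
    calc _ ≤ limsup (fun ε => ENNReal.ofReal a * g (ε / c)) (𝓝[>] 0) := limsup_le_limsup hle
      _ = ENNReal.ofReal a * limsup (fun ε => g (ε / c)) (𝓝[>] 0) :=
        ENNReal.limsup_const_mul_of_ne_top ENNReal.ofReal_ne_top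
      _ ≤ _ := by
        gcongr
        exact hlim.limsup_comp_le_limsup (u := g)
  have hcont : Tendsto (fun a : ℝ => ENNReal.ofReal a * limsup g (𝓝[>] 0)) (𝓝[>] 1)
      (𝓝 (ENNReal.ofReal 1 * limsup g (𝓝[>] 0))) := by
    refine ENNReal.Tendsto.mul_const ?_ (Or.inl (by simp))
    exact (ENNReal.continuous_ofReal.tendsto 1).mono_left nhdsWithin_le_nhds
  rw [ENNReal.ofReal_one, one_mul] at hcont
  exact ge_of_tendsto hcont (by filter_upwards [self_mem_nhdsWithin] with a ha using key a ha)

/-- Two functions of the scale have the same upper limit normalised by `log (1 / ε)` if one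
dominates the other and is dominated by it after a rescaling. -/
theorem limsup_div_log_eq {F G : ℝ → ℝ≥0∞} {c : ℝ} (hc : 0 < c)
    (hGF : ∀ ε, G ε ≤ F ε) (hFG : ∀ ε > 0, F (c * ε) ≤ G ε) :
    limsup (fun ε : ℝ => F ε / ENNReal.ofReal (Real.log (1 / ε))) (𝓝[>] 0) =
      limsup (fun ε : ℝ => G ε / ENNReal.ofReal (Real.log (1 / ε))) (𝓝[>] 0) :=
  le_antisymm (limsup_div_log_le hc hFG)
    (limsup_le_limsup (Eventually.of_forall fun ε => ENNReal.div_le_div_right (hGF ε) _))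

/-! ### A Frostman lemma for weighted covers -/

section Frostman

variable {X ι : Type*}

/-- The weighted sum `∑ c_i 1_{B_i}`, linear in the finitely supported weight `c`. -/
noncomputable def coverFun (B : ι → Set X) (c : ι →₀ ℝ) (x : X) : ℝ :=
  Finsupp.linearCombination ℝ (fun i => (B i).indicator (1 : X → ℝ) x) c

/-- The costs `∑ c_i a_i` of the finite weighted families with `f ≤ ∑ c_i 1_{B_i}` on `K`. -/
def coverCosts (B : ι → Set X) (a : ι → ℝ) (K : Set X) (f : X → ℝ) : Set ℝ :=
  {r | ∃ c : ι →₀ ℝ, 0 ≤ c ∧ (∀ x ∈ K, f x ≤ coverFun B c x) ∧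
    Finsupp.linearCombination ℝ a c = r}

variable {B : ι → Set X} {a : ι → ℝ} {K : Set X}

theorem coverCosts_nonneg (ha : ∀ i, 0 ≤ a i) {f : X → ℝ} {r : ℝ}
    (hr : r ∈ coverCosts B a K f) : 0 ≤ r := by
  obtain ⟨c, hc, -, rfl⟩ := hr
  rw [Finsupp.linearCombination_apply]
  exact Finsupp.sum_nonneg fun i _ => mul_nonneg (hc i) (ha i)

theorem coverCosts_bddBelow (ha : ∀ i, 0 ≤ a i) (f : X → ℝ) : BddBelow (coverCosts B a K f) :=
  ⟨0, fun _ h => coverCosts_nonneg ha h⟩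

theorem coverCosts_add {f g : X → ℝ} {r r' : ℝ} (hr : r ∈ coverCosts B a K f)
    (hr' : r' ∈ coverCosts B a K g) : r + r' ∈ coverCosts B a K (f + g) := by
  obtain ⟨c, hc, hf, rfl⟩ := hr
  obtain ⟨c', hc', hg, rfl⟩ := hr'
  refine ⟨c + c', add_nonneg hc hc', fun x hx => ?_, map_add _ _ _⟩
  simpa [coverFun] using add_le_add (hf x hx) (hg x hx)

theorem coverCosts_smul {f : X → ℝ} {r t : ℝ} (ht : 0 ≤ t) (hr : r ∈ coverCosts B a K f) :
    t * r ∈ coverCosts B a K (t • f) := by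
  obtain ⟨c, hc, hf, rfl⟩ := hr
  refine ⟨t • c, fun i => mul_nonneg ht (hc i), fun x hx => ?_, by simp⟩
  simpa [coverFun] using mul_le_mul_of_nonneg_left (hf x hx) ht

variable [TopologicalSpace X]

theorem coverCosts_nonempty (hK : IsCompact K) (hB : ∀ i, IsOpen (B i)) (hcov : K ⊆ ⋃ i, B i)
    {f : X → ℝ} (hf : Continuous f) : (coverCosts B a K f).Nonempty := by
  obtain ⟨t, ht⟩ := hK.elim_finite_subcover B hB hcov
  obtain ⟨M, hM⟩ := hK.bddAbove_image hf.continuousOn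
  refine ⟨_, ∑ i ∈ t, Finsupp.single i (max M 0), Finset.sum_nonneg fun i _ => ?_,
    fun x hx => ?_, rfl⟩
  · exact Finsupp.single_nonneg.2 (le_max_right _ _)
  · obtain ⟨i, hi, hxi⟩ : ∃ i ∈ t, x ∈ B i := by simpa using ht hx
    have h1 : f x ≤ max M 0 := (hM ⟨x, hx, rfl⟩).trans (le_max_left _ _)
    have h2 : max M 0 ≤ ∑ j ∈ t, max M 0 * (B j).indicator (1 : X → ℝ) x := by
      refine le_trans ?_ (Finset.single_le_sum (f := fun j => max M 0 *
        (B j).indicator (1 : X → ℝ) x) (fun j _ => mul_nonneg (le_max_right _ _)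
          (indicator_nonneg (fun _ _ => zero_le_one) _)) hi)
      simp [hxi]
    simpa [coverFun] using h1.trans h2

theorem sInf_coverCosts_smul_le (ha : ∀ i, 0 ≤ a i) (hK : IsCompact K) (hB : ∀ i, IsOpen (B i))
    (hcov : K ⊆ ⋃ i, B i) {f : X → ℝ} (hf : Continuous f) {t : ℝ} (ht : 0 < t) :
    sInf (coverCosts B a K (t • f)) ≤ t * sInf (coverCosts B a K f) := by
  rw [mul_comm, ← div_le_iff₀ ht]
  refine le_csInf (coverCosts_nonempty hK hB hcov hf) fun r hr => ?_
  rw [div_le_iff₀' ht]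
  exact csInf_le (coverCosts_bddBelow ha _) (coverCosts_smul ht.le hr)

open CompactlySupported in
/-- The Hahn–Banach step: the least cost of a weighted cover of `f` is sublinear in `f`, and hence
dominates a linear functional with the same value at the constant function `1`. -/
theorem exists_functional_le_coverCosts [CompactSpace X] (ha : ∀ i, 0 ≤ a i) (hK : IsCompact K)
    (hne : K.Nonempty) (hB : ∀ i, IsOpen (B i)) (hcov : K ⊆ ⋃ i, B i) :
    ∃ Λ : C_c(X, ℝ) →ₚ[ℝ] ℝ, (∀ f : C_c(X, ℝ), ∀ r ∈ coverCosts B a K f, Λ f ≤ r) ∧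
      ∀ f : C_c(X, ℝ), (∀ x, f x = 1) → Λ f = sInf (coverCosts B a K (1 : X → ℝ)) := by
  let p : C_c(X, ℝ) → ℝ := fun f => sInf (coverCosts B a K f)
  have hp0 (f) : 0 ≤ p f := Real.sInf_nonneg fun r hr => coverCosts_nonneg ha hr
  have hhom (t : ℝ) (ht : 0 < t) (f) : p (t • f) = t * p f := by
    refine le_antisymm (sInf_coverCosts_smul_le ha hK hB hcov f.continuous ht) ?_
    have := sInf_coverCosts_smul_le ha hK hB hcov
      (f := ⇑(t • f)) (t • f).continuous (inv_pos.2 ht)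
    have h2 : (t⁻¹ • ⇑(t • f) : X → ℝ) = f := by
      ext x; simp [ht.ne']
    rw [h2, ← div_eq_inv_mul, le_div_iff₀' ht] at this
    exact this
  have hadd (f g) : p (f + g) ≤ p f + p g := by
    refine le_of_forall_pos_le_add fun η hη => ?_
    obtain ⟨r, hr, hr1⟩ := exists_lt_of_csInf_lt (coverCosts_nonempty hK hB hcov f.continuous)
      (lt_add_of_pos_right (p f) (half_pos hη))
    obtain ⟨r', hr', hr1'⟩ := exists_lt_of_csInf_lt (coverCosts_nonempty hK hB hcov g.continuous)
      (lt_add_of_pos_right (p g) (half_pos hη))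
    have : p (f + g) ≤ r + r' := csInf_le (coverCosts_bddBelow ha _) (coverCosts_add hr hr')
    linarith
  let o : C_c(X, ℝ) :=
    { toFun := 1
      hasCompactSupport' := HasCompactSupport.of_compactSpace 1 }
  have ho : o ≠ 0 := fun h => by
    simpa [o] using! DFunLike.congr_fun h hne.some
  obtain ⟨g, hg1, hg⟩ := exists_extension_of_le_sublinear
    (LinearPMap.mkSpanSingleton o (p o) ho) p hhom hadd (by
      rintro ⟨f, hf⟩
      obtain ⟨t, rfl⟩ := Submodule.mem_span_singleton.1 hf
      rw [LinearPMap.mkSpanSingleton'_apply]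
      rcases lt_or_ge 0 t with ht | ht
      · exact (hhom t ht o).ge
      · exact (mul_nonpos_of_nonpos_of_nonneg ht (hp0 o)).trans (hp0 _))
  have hgr : ∀ f : C_c(X, ℝ), ∀ r ∈ coverCosts B a K f, g f ≤ r := fun f r hr =>
    (hg f).trans (csInf_le (coverCosts_bddBelow ha _) hr)
  have hpos : ∀ f, 0 ≤ f → 0 ≤ g f := fun f hf => by
    -- `-f ≤ 0` is covered by the zero weight
    have : g (-f) ≤ 0 := hgr _ 0 ⟨0, le_rfl, fun x _ => by simpa [coverFun] using hf x, by simp⟩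
    simpa using this
  refine ⟨PositiveLinearMap.mk₀ g hpos, hgr, fun f hf => ?_⟩
  have hfo : f = o := by ext x; simpa [o] using! hf x
  have := hg1 ⟨o, Submodule.mem_span_singleton_self o⟩
  rw [LinearPMap.mkSpanSingleton_apply] at this
  rw [hfo]
  exact this

open CompactlySupported in
/-- A bound for a positive functional on the bump functions inside an open set bounds the measure
of that set. -/
theorem rieszMeasure_le_of_isOpen [CompactSpace X] [T2Space X] [MeasurableSpace X] [BorelSpace X]
    (Λ : C_c(X, ℝ) →ₚ[ℝ] ℝ) {U : Set X} (hU : IsOpen U) {b : ℝ}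
    (h : ∀ f : C_c(X, ℝ), (∀ x, 0 ≤ f x ∧ f x ≤ 1) → (∀ x ∉ U, f x = 0) → Λ f ≤ b) :
    RealRMK.rieszMeasure Λ U ≤ ENNReal.ofReal b := by
  rw [hU.measure_eq_iSup_isCompact]
  refine iSup₂_le fun C hCU => iSup_le fun hC => ?_
  obtain ⟨f, hf1, hf0, -, hf⟩ := exists_continuous_one_zero_of_isCompact hC
    hU.isClosed_compl (disjoint_compl_right_iff_subset.2 hCU)
  let f' : C_c(X, ℝ) :=
    { toFun := f
      hasCompactSupport' := HasCompactSupport.of_compactSpace _ }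
  refine (RealRMK.rieszMeasure_le_of_eq_one Λ (f := f') (fun x => (hf x).1) hC
    fun x hx => hf1 hx).trans (ENNReal.ofReal_le_ofReal (h f' hf fun x hx => hf0 hx))

/-- If every finite weighted cover of `K` by the open sets `B i` costs at least `η > 0`, then some
probability measure on `K` satisfies `μ (B i) ≤ a i / η` for all `i`. -/
theorem exists_measure_le_cost [CompactSpace X] [T2Space X] [MeasurableSpace X] [BorelSpace X]
    (ha : ∀ i, 0 ≤ a i) (hK : IsCompact K) (hne : K.Nonempty) (hB : ∀ i, IsOpen (B i))
    (hcov : K ⊆ ⋃ i, B i) {η : ℝ} (hη : 0 < η)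
    (h : ∀ r ∈ coverCosts B a K (1 : X → ℝ), η ≤ r) :
    ∃ μ : ProbabilityMeasure X, (μ : Measure X) K = 1 ∧
      ∀ i, (μ : Measure X) (B i) ≤ ENNReal.ofReal (a i / η) := by
  obtain ⟨Λ, hΛ, hΛ1⟩ := exists_functional_le_coverCosts ha hK hne hB hcov
  set ν := RealRMK.rieszMeasure Λ with hν
  set m := sInf (coverCosts B a K (1 : X → ℝ))
  have hηm : η ≤ m := le_csInf (coverCosts_nonempty hK hB hcov continuous_one) h
  have huniv : ν univ = ENNReal.ofReal m := by
    let o : CompactlySupportedContinuousMap X ℝ :=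
      { toFun := 1
        hasCompactSupport' := HasCompactSupport.of_compactSpace 1 }
    have ho : Λ o = m := hΛ1 o fun x => rfl
    refine le_antisymm ?_ ?_
    · rw [← ho]
      exact RealRMK.rieszMeasure_le_of_eq_one Λ (fun x => zero_le_one) isCompact_univ
        fun x _ => rfl
    · rw [← ho]
      exact RealRMK.le_rieszMeasure_tsupport_subset Λ (fun x => ⟨zero_le_one, le_rfl⟩)
        (subset_univ _)
  -- functions vanishing on `K` are covered by the zero weight
  have hKc : ν Kᶜ = 0 := by
    refine le_antisymm ?_ bot_le
    rw [← ENNReal.ofReal_zero]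
    refine rieszMeasure_le_of_isOpen Λ hK.isClosed.isOpen_compl fun f _ hf => ?_
    exact hΛ f 0 ⟨0, le_rfl, fun x hx => by simp [coverFun, hf x (not_not.2 hx)], by simp⟩
  have hBi (i) : ν (B i) ≤ ENNReal.ofReal (a i) := by
    refine rieszMeasure_le_of_isOpen Λ (hB i) fun f hf hf0 => ?_
    refine hΛ f _ ⟨Finsupp.single i 1, Finsupp.single_nonneg.2 zero_le_one, fun x _ => ?_,
      by simp⟩
    by_cases hx : x ∈ B i
    · simpa [coverFun, hx] using (hf x).2
    · simp [coverFun, hx, hf0 x hx]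
  have hm : 0 < m := hη.trans_le hηm
  have hm0 : ENNReal.ofReal m ≠ 0 := by simpa using hm
  have hν1 : IsProbabilityMeasure ((ENNReal.ofReal m)⁻¹ • ν) :=
    ⟨by simp [huniv, ENNReal.inv_mul_cancel hm0 ENNReal.ofReal_ne_top]⟩
  refine ⟨⟨(ENNReal.ofReal m)⁻¹ • ν, hν1⟩, ?_, fun i => ?_⟩
  · exact (prob_compl_eq_zero_iff (μ := (ENNReal.ofReal m)⁻¹ • ν) hK.measurableSet).1
      (by simp [hKc])
  · change (ENNReal.ofReal m)⁻¹ * ν (B i) ≤ _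
    rw [← ENNReal.ofReal_inv_of_pos hm, div_eq_inv_mul, ENNReal.ofReal_mul (by positivity)]
    gcongr
    exact hBi i

end Frostman

/-! ### From weighted covers to covers, and the Bowen variational inequality -/

section Bowen

theorem weight_coe_finset {X : Type*} (s : ℝ≥0) (I : Finset (ℕ × X)) :
    weight s (I : Set (ℕ × X)) = ENNReal.ofReal (∑ i ∈ I, Real.exp (-(i.1 * s))) := by
  rw [ENNReal.ofReal_sum_of_nonneg fun _ _ => (Real.exp_pos _).le]
  exact Finset.tsum_subtype' I fun i => ENNReal.ofReal (Real.exp (-((i.1 : ℝ) * s)))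

variable {X : Type*} [MetricSpace X] {T : X → X}

/-- The points where a weighted family of balls of the same order `n` and radius `ε` has
multiplicity more than `t` are covered by few balls of order `n` and radius `2 * ε`: the centres
of the weighted balls containing a point `y` lie in the ball of radius `ε` around `y`, and these are
disjoint for a suitable set of points `y`. -/
theorem exists_finset_cover_of_multiplicity (T : X → X) (n : ℕ) {ε t : ℝ} (hε : 0 < ε)
    (ht : 0 < t) {ι : Type*} (J : Finset ι) (z : ι → X) {c : ι → ℝ} (hc : ∀ i ∈ J, 0 ≤ c i) :
    ∃ F : Finset X, F.card * t ≤ ∑ i ∈ J, c i ∧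
      ∀ x, t < ∑ i ∈ J, c i * (bowenBall T n (z i) ε).indicator (1 : X → ℝ) x →
        ∃ y ∈ F, x ∈ bowenBall T n y (2 * ε) := by
  classical
  set Z : Set X := {x | t < ∑ i ∈ J, c i * (bowenBall T n (z i) ε).indicator (1 : X → ℝ) x}
  obtain ⟨u, huZ, hu, hcov⟩ := Vitali.exists_disjoint_subfamily_covering_enlargement
    (fun y => bowenBall T n y ε) Z (fun _ => 0) 2 one_lt_two (fun _ _ => le_rfl) 0
    (fun _ _ => le_rfl) fun y _ => ⟨y, mem_bowenBall_self hε⟩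
  have hcard (F : Finset X) (hF : (F : Set X) ⊆ u) : F.card * t ≤ ∑ i ∈ J, c i := by
    calc (F.card : ℝ) * t = ∑ y ∈ F, t := by simp
      _ ≤ ∑ y ∈ F, ∑ i ∈ J, c i * (bowenBall T n (z i) ε).indicator (1 : X → ℝ) y :=
        Finset.sum_le_sum fun y hy => le_of_lt (huZ (hF hy))
      _ = ∑ i ∈ J, c i * ∑ y ∈ F, (bowenBall T n (z i) ε).indicator (1 : X → ℝ) y := by
        rw [Finset.sum_comm]
        simp_rw [Finset.mul_sum]
      _ ≤ ∑ i ∈ J, c i * 1 := by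
        refine Finset.sum_le_sum fun i hi => mul_le_mul_of_nonneg_left ?_ (hc i hi)
        simp only [indicator_apply, Pi.one_apply, Finset.sum_boole, Nat.cast_le_one,
          Finset.card_le_one, Finset.mem_filter]
        intro y hy y' hy'
        by_contra hne
        have hz : z i ∈ bowenBall T n y ε := (bowenDist_comm n y (z i)).trans_lt hy.2
        have hz' : z i ∈ bowenBall T n y' ε := (bowenDist_comm n y' (z i)).trans_lt hy'.2
        exact disjoint_left.1 (hu (hF hy.1) (hF hy'.1) hne) hz hz'
      _ = _ := by simp
  have hfin : u.Finite := by
    by_contra hinf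
    obtain ⟨k, hk⟩ := exists_nat_gt ((∑ i ∈ J, c i) / t)
    obtain ⟨F, hF, hFk⟩ := Set.Infinite.exists_subset_card_eq hinf k
    have := hcard F hF
    rw [hFk, ← le_div_iff₀ ht] at this
    linarith
  refine ⟨hfin.toFinset, hcard _ (by simp), fun x hx => ?_⟩
  obtain ⟨y, hy, ⟨w, hw, hw'⟩, -⟩ := hcov x hx
  refine ⟨y, by simpa using hy, ?_⟩
  have h1 := bowenDist_triangle (T := T) n y w x
  rw [bowenDist_comm n w x] at h1
  have h2 := mem_bowenBall.1 hw
  have h3 := mem_bowenBall.1 hw'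
  exact mem_bowenBall.2 (by linarith)

/-- A finite weighted cover of cost `r` for the exponent `s` yields a cover by balls of twice the
radius whose cost for a larger exponent `t` is at most a constant times `r`. A point with total
multiplicity at least `1` has multiplicity more than `τ n = (1 - q) q ^ n / 2` on some
level `n`, where `q = exp (-(t - s))`, because these thresholds have sum `1 / 2`. -/
theorem bowenMN_le_of_weighted_cover {K : Set X} {s t : ℝ≥0} (hst : s < t) {N : ℕ} {ε : ℝ}
    (hε : 0 < ε) {ι : Type*} {J : Finset ι} {p : ι → ℕ × X} (hJ : ∀ i ∈ J, N ≤ (p i).1)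
    {c : ι → ℝ} (hc : ∀ i ∈ J, 0 ≤ c i)
    (hK : ∀ x ∈ K, 1 ≤ ∑ i ∈ J, c i * (bowenBall T (p i).1 (p i).2 ε).indicator (1 : X → ℝ) x) :
    bowenMN T K t N (2 * ε) ≤ ENNReal.ofReal
      (2 / (1 - Real.exp (-((t : ℝ) - s))) * ∑ i ∈ J, c i * Real.exp (-((p i).1 * s))) := by
  classical
  set q : ℝ := Real.exp (-((t : ℝ) - s)) with hq
  have hq0 : 0 < q := Real.exp_pos _
  have hst' : (s : ℝ) < t := hst
  have hq1 : q < 1 := Real.exp_lt_one_iff.2 (by linarith)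
  let τ : ℕ → ℝ := fun n => (1 - q) / 2 * q ^ n
  have hτ (n) : 0 < τ n := by
    have : 0 < 1 - q := by linarith
    positivity
  have hτsum : HasSum τ (1 / 2) := by
    have h := (hasSum_geometric_of_lt_one hq0.le hq1).mul_left ((1 - q) / 2)
    have : 1 - q ≠ 0 := by linarith
    rwa [div_mul_eq_mul_div, mul_inv_cancel₀ this] at h
  let lev (n : ℕ) : Finset ι := J.filter fun i => (p i).1 = n
  have hlev (n) (i) (hi : i ∈ lev n) : i ∈ J ∧ (p i).1 = n := Finset.mem_filter.1 hi
  choose F hFcard hFcov using fun n => exists_finset_cover_of_multiplicity T n hε (hτ n) (lev n)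
    (fun i => (p i).2) fun i hi => hc i (hlev n i hi).1
  set L : Finset ℕ := J.image fun i => (p i).1
  have hmaps (i) (hi : i ∈ J) : (p i).1 ∈ L := Finset.mem_image_of_mem (fun i => (p i).1) hi
  let I : Finset (ℕ × X) := L.biUnion fun n => (F n).image (Prod.mk n)
  have hmemI (w : ℕ × X) : w ∈ I ↔ w.1 ∈ L ∧ w.2 ∈ F w.1 := by
    obtain ⟨n, x⟩ := w
    simp only [I, Finset.mem_biUnion, Finset.mem_image, Prod.mk.injEq]
    constructor
    · rintro ⟨n, hn, y, hy, rfl, rfl⟩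
      exact ⟨hn, hy⟩
    · rintro ⟨hn, hx⟩
      exact ⟨n, hn, x, hx, rfl, rfl⟩
  refine iInf_le_of_le (I : Set (ℕ × X)) (iInf_le_of_le I.countable_toSet
    (iInf_le_of_le (fun w hw => ?_) (iInf_le_of_le (fun x hx => ?_) ?_)))
  · obtain ⟨i, hi, h⟩ := Finset.mem_image.1 ((hmemI w).1 hw).1
    exact h ▸ hJ i hi
  · obtain ⟨n, hn, hlt⟩ : ∃ n ∈ L, τ n < ∑ i ∈ lev n,
        c i * (bowenBall T n (p i).2 ε).indicator (1 : X → ℝ) x := by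
      by_contra! hcon
      have h1 := hK x hx
      rw [← Finset.sum_fiberwise_of_maps_to hmaps] at h1
      have h2 := h1.trans (Finset.sum_le_sum fun n hn => (Finset.sum_congr rfl fun i hi => by
        rw [(hlev n i hi).2]).le.trans (hcon n hn))
      have h3 := sum_le_hasSum L (fun n _ => (hτ n).le) hτsum
      linarith
    obtain ⟨y, hy, hxy⟩ := hFcov n x hlt
    exact mem_biUnion (x := (n, y)) ((hmemI _).2 ⟨hn, hy⟩) hxy
  · rw [weight_coe_finset]
    refine ENNReal.ofReal_le_ofReal ?_
    have hexp (n : ℕ) : Real.exp (-(n * t)) = Real.exp (-(n * s)) * q ^ n := by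
      rw [hq, ← Real.exp_nat_mul, ← Real.exp_add]
      congr 1
      ring
    calc ∑ i ∈ I, Real.exp (-(i.1 * t))
        ≤ ∑ n ∈ L, ∑ i ∈ (F n).image (Prod.mk n), Real.exp (-(i.1 * t)) := by
          rw [Finset.sum_biUnion]
          intro n _ m _ hnm
          refine Finset.disjoint_left.2 fun w hw hw' => hnm ?_
          obtain ⟨_, -, rfl⟩ := Finset.mem_image.1 hw
          obtain ⟨_, -, h⟩ := Finset.mem_image.1 hw'
          exact (congrArg Prod.fst h).symm
      _ = ∑ n ∈ L, (F n).card * Real.exp (-(n * t)) := by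
          refine Finset.sum_congr rfl fun n _ => ?_
          rw [Finset.sum_image (by simp)]
          simp
      _ ≤ ∑ n ∈ L, 2 / (1 - q) * ∑ i ∈ lev n, c i * Real.exp (-((p i).1 * s)) := by
          refine Finset.sum_le_sum fun n _ => ?_
          have h1 : ∑ i ∈ lev n, c i * Real.exp (-((p i).1 * s)) =
              (∑ i ∈ lev n, c i) * Real.exp (-(n * s)) := by
            rw [Finset.sum_mul]
            exact Finset.sum_congr rfl fun i hi => by rw [(hlev n i hi).2]
          have h2 : (F n).card * Real.exp (-(n * t)) =
              2 / (1 - q) * ((F n).card * τ n * Real.exp (-(n * s))) := by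
            have : 1 - q ≠ 0 := by linarith
            rw [hexp]
            simp only [τ]
            field_simp
          rw [h1, h2]
          have : 0 < 1 - q := by linarith
          gcongr
          exact hFcard n
      _ = _ := by rw [← Finset.mul_sum, Finset.sum_fiberwise_of_maps_to hmaps]

/-- The mass distribution principle: families of balls capturing more than `1 - δ` of the mass of a
Frostman measure have cost bounded below. -/
theorem le_katokEntropy_of_measure_bowenBall_le [MeasurableSpace X] {μ : Measure X}
    {s : ℝ≥0} {ε C : ℝ} {N : ℕ}
    (hC : 0 < C) (hμ : ∀ n ≥ N, ∀ x, μ (bowenBall T n x ε) ≤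
      ENNReal.ofReal (C * Real.exp (-(n * s)))) : (s : ℝ≥0∞) ≤ katokEntropy T μ ε := by
  have hδ : (1 / 2 : ℝ) ∈ Ioo (0 : ℝ) 1 := by norm_num
  refine le_trans ?_ (le_iSup₂ (f := fun δ (_ : δ ∈ Ioo (0 : ℝ) 1) => katokEntropyDelta T μ δ ε)
    _ hδ)
  refine le_iInf_of_ne_zero (katokM_anti μ _ ε) fun h0 => ?_
  have h1 : ENNReal.ofReal (1 - 1 / 2) / ENNReal.ofReal C ≤ katokMN T μ (1 / 2) s N ε := by
    refine le_iInf fun I => le_iInf fun hc => le_iInf fun hN => le_iInf fun hI => ?_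
    refine ENNReal.div_le_of_le_mul' (hI.le.trans ?_)
    refine (measure_biUnion_le μ hc _).trans ?_
    rw [weight, ← ENNReal.tsum_mul_left]
    refine ENNReal.tsum_le_tsum fun i => ?_
    rw [← ENNReal.ofReal_mul hC.le]
    exact hμ _ (hN _ i.2) _
  have h2 : katokMN T μ (1 / 2) s N ε ≤ 0 := h0 ▸ le_iSup (fun N => katokMN T μ (1 / 2) s N ε) N
  have h3 := h1.trans h2
  rw [nonpos_iff_eq_zero, ENNReal.div_eq_zero_iff] at h3
  norm_num at h3

variable [CompactSpace X] [MeasurableSpace X] [BorelSpace X]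

/-- The dynamical Frostman lemma: if `K` has positive Bowen outer measure, there is a probability
measure on `K` under which balls of order `n` have mass `O(e^{-ns})`. -/
theorem exists_frostman_measure (hT : Continuous T) {K : Set X} (hK : IsCompact K) {s t : ℝ≥0}
    (hst : s < t) {ε : ℝ} (hε : 0 < ε) (h : bowenM T K t (2 * ε) ≠ 0) :
    ∃ μ : ProbabilityMeasure X, (μ : Measure X) K = 1 ∧ ∃ (N : ℕ) (C : ℝ), 0 < C ∧
      ∀ n ≥ N, ∀ x, (μ : Measure X) (bowenBall T n x ε) ≤
        ENNReal.ofReal (C * Real.exp (-(n * s))) := by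
  obtain ⟨N, hN⟩ : ∃ N, bowenMN T K t N (2 * ε) ≠ 0 := by
    by_contra! hcon
    exact h (by simp [bowenM, hcon])
  set D := 2 / (1 - Real.exp (-((t : ℝ) - s))) with hDdef
  have hD : 0 < D := by
    have hst' : (s : ℝ) < t := hst
    have : Real.exp (-((t : ℝ) - s)) < 1 := Real.exp_lt_one_iff.2 (by linarith)
    have : 0 < 1 - Real.exp (-((t : ℝ) - s)) := by linarith
    positivity
  have hne : K.Nonempty := by
    by_contra hcon
    refine hN (le_antisymm ?_ bot_le)
    refine iInf_le_of_le ∅ (iInf_le_of_le countable_empty (iInf_le_of_le (by simp)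
      (iInf_le_of_le ?_ (by simp [weight]))))
    simp [not_nonempty_iff_eq_empty.1 hcon]
  -- a real lower bound for the (possibly infinite) value of the outer measure
  obtain ⟨η, hη, hηN⟩ : ∃ η : ℝ, 0 < η ∧ ENNReal.ofReal (D * η) ≤ bowenMN T K t N (2 * ε) := by
    obtain ⟨b, hb, hbN⟩ := ENNReal.lt_iff_exists_nnreal_btwn.1 (pos_iff_ne_zero.2 hN)
    refine ⟨b / D, div_pos (by exact_mod_cast hb) hD, ?_⟩
    rw [mul_div_cancel₀ _ hD.ne', ENNReal.ofReal_coe_nnreal]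
    exact hbN.le
  obtain ⟨μ, hμK, hμ⟩ := exists_measure_le_cost (ι := {i : ℕ × X // N ≤ i.1})
    (B := fun i => bowenBall T i.1.1 i.1.2 ε) (a := fun i => Real.exp (-(i.1.1 * s)))
    (fun i => (Real.exp_pos _).le) hK hne (fun i => isOpen_bowenBall hT hε)
    (fun x _ => mem_iUnion.2 ⟨⟨(N, x), le_rfl⟩, mem_bowenBall_self hε⟩) hη (by
      rintro _ ⟨c, hc, hcov, rfl⟩
      have hle := bowenMN_le_of_weighted_cover (T := T) (K := K) hst hε (N := N)
        (J := c.support) (p := Subtype.val) (c := c) (fun i _ => i.2) (fun i _ => hc i)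
        (fun x hx => by
          have := hcov x hx
          rwa [coverFun, Finsupp.linearCombination_apply] at this)
      have := hηN.trans hle
      rw [ENNReal.ofReal_le_ofReal_iff', ← hDdef] at this
      rw [Finsupp.linearCombination_apply]
      rcases this with this | this
      · exact le_of_mul_le_mul_left this hD
      · exact absurd this (not_le.2 (mul_pos hD hη)))
  refine ⟨μ, hμK, N, η⁻¹, inv_pos.2 hη, fun n hn x => ?_⟩
  have := hμ ⟨(n, x), hn⟩
  rwa [div_eq_inv_mul] at this

theorem bowenEntropy_le_iSup_katokEntropy (hT : Continuous T) {K : Set X} (hK : IsCompact K)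
    {ε : ℝ} (hε : 0 < ε) :
    bowenEntropy T K (2 * ε) ≤
      ⨆ (μ : ProbabilityMeasure X) (_ : (μ : Measure X) K = 1),
        katokEntropy T (μ : Measure X) ε := by
  refine le_of_forall_lt fun r hr => ?_
  obtain ⟨s, hrs, hs⟩ := ENNReal.lt_iff_exists_nnreal_btwn.1 hr
  obtain ⟨t, hst, ht⟩ := ENNReal.lt_iff_exists_nnreal_btwn.1 hs
  obtain ⟨μ, hμK, N, C, hC, hμ⟩ := exists_frostman_measure hT hK (ENNReal.coe_lt_coe.1 hst) hε
    (ne_zero_of_lt_iInf (f := fun t => bowenM T K t (2 * ε)) ht)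
  exact hrs.trans_le ((le_katokEntropy_of_measure_bowenBall_le hC hμ).trans
    (le_iSup₂ (f := fun (μ : ProbabilityMeasure X) (_ : (μ : Measure X) K = 1) =>
      katokEntropy T (μ : Measure X) ε) μ hμK))

end Bowen

/-! ### Separated sets inside sets of positive packing measure -/

section Packing

variable {X : Type*} [MetricSpace X] {T : X → X}

/-- `packOuter T · s ε` as an outer measure. -/
noncomputable def packOuterMeasure (T : X → X) (s : ℝ≥0) (ε : ℝ) : OuterMeasure X where
  measureOf Z := packOuter T Z s ε
  empty := le_antisymm ((packOuter_le_packP ∅ s ε).trans (packP_empty s ε).le) bot_le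
  mono h := packOuter_mono h s ε
  iUnion_nat Z _ := packOuter_iUnion_le Z s ε

/-- A compact set `K` of positive packing outer measure contains a compact set all of whose
nonempty relatively open subsets have positive packing outer measure: the relatively open null
subsets of `K` are removed. -/
theorem exists_isCompact_forall_packOuter_ne_zero [CompactSpace X] {K : Set X} (hK : IsCompact K)
    {s : ℝ≥0} {ε : ℝ} (h : packOuter T K s ε ≠ 0) :
    ∃ K' ⊆ K, IsCompact K' ∧ K'.Nonempty ∧
      ∀ V, IsOpen V → (V ∩ K').Nonempty → packOuter T (V ∩ K') s ε ≠ 0 := by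
  let m := packOuterMeasure T s ε
  let S : Set (Set X) := {V ∈ TopologicalSpace.countableBasis X | m (V ∩ K) = 0}
  have hSc : S.Countable := (TopologicalSpace.countable_countableBasis X).mono (sep_subset _ _)
  have hSo : IsOpen (⋃₀ S) := isOpen_sUnion fun V hV =>
    TopologicalSpace.isOpen_of_mem_countableBasis hV.1
  have hS0 : m (⋃₀ S ∩ K) = 0 := by
    rw [sUnion_eq_biUnion, iUnion₂_inter]
    exact (measure_biUnion_null_iff hSc).2 fun V hV => hV.2
  refine ⟨K \ ⋃₀ S, sdiff_subset, hK.diff hSo, ?_, fun V hV ⟨x, hxV, hxK⟩ h0 => ?_⟩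
  · by_contra hcon
    rw [not_nonempty_iff_eq_empty, sdiff_eq_empty] at hcon
    exact h (measure_mono_null (μ := m) (show K ⊆ ⋃₀ S ∩ K from fun x hx => ⟨hcon hx, hx⟩) hS0)
  · obtain ⟨B, hB, hxB, hBV⟩ :=
      (TopologicalSpace.isBasis_countableBasis X).exists_subset_of_mem_open hxV hV
    refine hxK.2 (mem_sUnion.2 ⟨B, ⟨hB, ?_⟩, hxB⟩)
    refine measure_mono_null (μ := m) (t := (V ∩ (K \ ⋃₀ S)) ∪ (⋃₀ S ∩ K)) (fun y hy => ?_)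
      (measure_union_null h0 hS0)
    by_cases hyS : y ∈ ⋃₀ S
    · exact Or.inr ⟨hyS, hy.2⟩
    · exact Or.inl ⟨hBV hy.1, hy.2, hyS⟩

theorem weight_le_of_forall_finset {X : Type*} {s : ℝ≥0} {I : Set (ℕ × X)} {r : ℝ}
    (h : ∀ F : Finset (ℕ × X), (F : Set (ℕ × X)) ⊆ I → ∑ i ∈ F, Real.exp (-(i.1 * s)) ≤ r) :
    weight s I ≤ ENNReal.ofReal r := by
  refine ENNReal.summable.tsum_le_of_sum_le fun F => ?_
  rw [← ENNReal.ofReal_sum_of_nonneg fun _ _ => (Real.exp_pos _).le]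
  refine ENNReal.ofReal_le_ofReal ?_
  have := h (F.map (Function.Embedding.subtype _)) (by simp)
  rwa [Finset.sum_map] at this

/-- A set of positive packing quantity for the exponent `t > s` contains large separated sets of
arbitrarily large order: if for all `n ≥ N` every `(n, ε)`-separated subset of `W` had fewer than
`e ^ (n s)` points, the packing sums of `W` would be dominated by the tails of the geometric series
with ratio `e ^ (-(t - s))`. -/
theorem exists_separated_of_packP_ne_zero {W : Set X} {s t : ℝ≥0} (hst : s < t) {ε : ℝ}
    (hε : 0 ≤ ε) (h : packP T W t ε ≠ 0) (N : ℕ) :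
    ∃ n ≥ N, ∃ E : Finset X, (E : Set X) ⊆ W ∧
      (∀ x ∈ E, ∀ y ∈ E, x ≠ y → ε < bowenDist T n x y) ∧ Real.exp (n * s) ≤ E.card := by
  classical
  by_contra! hcon
  have hst' : (s : ℝ) < t := hst
  set q : ℝ := Real.exp (-((t : ℝ) - s)) with hq
  have hq0 : 0 < q := Real.exp_pos _
  have hq1 : q < 1 := Real.exp_lt_one_iff.2 (by linarith)
  have hexp (n : ℕ) : Real.exp (n * s) * Real.exp (-(n * t)) = q ^ n := by
    rw [hq, ← Real.exp_nat_mul, ← Real.exp_add]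
    congr 1
    ring
  have key (M : ℕ) (hM : N ≤ M) : packP T W t ε ≤ ENNReal.ofReal (q ^ M * (1 - q)⁻¹) := by
    refine iInf_le_of_le M ?_
    refine iSup_le fun I => iSup_le fun _ => iSup_le fun hI => iSup_le fun hd => ?_
    refine weight_le_of_forall_finset fun F hF => ?_
    set L : Finset ℕ := F.image Prod.fst
    have hmaps (i) (hi : i ∈ F) : i.1 ∈ L := Finset.mem_image_of_mem _ hi
    have hLM (n) (hn : n ∈ L) : M ≤ n := by
      obtain ⟨i, hi, rfl⟩ := Finset.mem_image.1 hn
      exact (hI i (hF hi)).1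
    have hfib (n) (hn : n ∈ L) :
        ∑ i ∈ F with i.1 = n, Real.exp (-(i.1 * t)) ≤ q ^ n := by
      have hinj : Set.InjOn Prod.snd ((F.filter fun i => i.1 = n : Finset (ℕ × X)) :
          Set (ℕ × X)) := by
        intro i hi j hj hij
        have hi' := (Finset.mem_filter.1 hi).2
        have hj' := (Finset.mem_filter.1 hj).2
        exact Prod.ext (hi'.trans hj'.symm) hij
      have hcard := hcon n (hM.trans (hLM n hn)) ((F.filter fun i => i.1 = n).image Prod.snd)
        (by
          intro x hx
          obtain ⟨i, hi, rfl⟩ := Finset.mem_image.1 hx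
          exact (hI i (hF (Finset.mem_filter.1 hi).1)).2)
        (by
          intro x hx y hy hxy
          obtain ⟨i, hi, rfl⟩ := Finset.mem_image.1 hx
          obtain ⟨j, hj, rfl⟩ := Finset.mem_image.1 hy
          obtain ⟨hiF, rfl⟩ := Finset.mem_filter.1 hi
          obtain ⟨hjF, hj'⟩ := Finset.mem_filter.1 hj
          by_contra hle
          refine disjoint_left.1 (hd (hF hiF) (hF hjF) fun h => hxy (h ▸ rfl))
            (mem_bowenClosedBall.2 (not_lt.1 hle)) (mem_bowenClosedBall.2 ?_)
          simpa using hε)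
      rw [Finset.card_image_of_injOn hinj] at hcard
      calc ∑ i ∈ F with i.1 = n, Real.exp (-(i.1 * t))
          = ∑ i ∈ F with i.1 = n, Real.exp (-(n * t)) :=
            Finset.sum_congr rfl fun i hi => by rw [(Finset.mem_filter.1 hi).2]
        _ = (F.filter fun i => i.1 = n).card * Real.exp (-(n * t)) := by simp
        _ ≤ Real.exp (n * s) * Real.exp (-(n * t)) := by gcongr
        _ = q ^ n := hexp n
    rw [← Finset.sum_fiberwise_of_maps_to hmaps]
    have hsum : HasSum (fun k => q ^ M * q ^ k) (q ^ M * (1 - q)⁻¹) :=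
      (hasSum_geometric_of_lt_one hq0.le hq1).mul_left _
    have hshift : Set.InjOn (· - M) (L : Set ℕ) := fun a ha b hb hab => by
      have := hLM a ha
      have := hLM b hb
      dsimp only at hab
      omega
    calc ∑ n ∈ L, ∑ i ∈ F with i.1 = n, Real.exp (-(i.1 * t)) ≤ ∑ n ∈ L, q ^ n :=
          Finset.sum_le_sum hfib
      _ = ∑ k ∈ L.image (· - M), q ^ M * q ^ k := by
          rw [Finset.sum_image (s := L) (g := (· - M)) hshift]
          exact Finset.sum_congr rfl fun n hn => by rw [← pow_add, Nat.add_sub_cancel' (hLM n hn)]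
      _ ≤ _ := sum_le_hasSum _ (fun _ _ => by positivity) hsum
  have hlim : Tendsto (fun M => ENNReal.ofReal (q ^ M * (1 - q)⁻¹)) atTop (𝓝 0) := by
    have := (tendsto_pow_atTop_nhds_zero_of_lt_one hq0.le hq1).mul_const (1 - q)⁻¹
    rw [zero_mul] at this
    simpa using ENNReal.tendsto_ofReal this
  refine h (le_antisymm (ge_of_tendsto hlim ?_) bot_le)
  filter_upwards [eventually_ge_atTop N] with M hM using key M hM

end Packing

/-! ### Construction of a measure with small balls -/

section MassScheme

universe u

variable {X : Type u} [MetricSpace X]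

/-- A finite distribution of unit mass over pieces of a set `K`: closed subsets `C i` of `K`, each
containing a nonempty relatively open subset of `K` and carrying the mass `w i`, such that the
Bowen ball of order `n i` and radius `r` around any point of `C i` avoids the other pieces, while
`w i ≤ e ^ (-(n i) s)`. -/
structure MassScheme (T : X → X) (K : Set X) (s r : ℝ) where
  /-- The index set of the pieces. -/
  ι : Type u
  /-- There are finitely many pieces. -/
  fintype : Fintype ι
  /-- The pieces. -/
  C : ι → Set X
  /-- The orders of the Bowen balls. -/
  n : ι → ℕ
  /-- The masses of the pieces. -/
  w : ι → ℝ≥0∞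
  isClosed : ∀ i, IsClosed (C i)
  subset : ∀ i, C i ⊆ K
  fat : ∀ i, ∃ V, IsOpen V ∧ (V ∩ K).Nonempty ∧ V ∩ K ⊆ C i
  sum_w : ∑ i, w i = 1
  w_le : ∀ i, w i ≤ ENNReal.ofReal (Real.exp (-(n i * s)))
  lt_bowenDist : ∀ i j, i ≠ j → ∀ x ∈ C i, ∀ y ∈ C j, r < bowenDist T (n i) x y

namespace MassScheme

attribute [instance] MassScheme.fintype

variable {T : X → X} {K : Set X} {s r : ℝ}

theorem disjoint (S : MassScheme T K s r) (hr : 0 ≤ r) {i j : S.ι} (hij : i ≠ j) :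
    Disjoint (S.C i) (S.C j) :=
  disjoint_left.2 fun x hi hj => by
    have := S.lt_bowenDist i j hij x hi x hj
    rw [bowenDist_self] at this
    linarith

theorem w_le_one (S : MassScheme T K s r) (i : S.ι) : S.w i ≤ 1 :=
  S.sum_w ▸ Finset.single_le_sum (f := S.w) (fun _ _ => bot_le) (Finset.mem_univ i)

/-- The scheme with a single piece. -/
def single (hK : IsClosed K) (hne : K.Nonempty) : MassScheme T K s r where
  ι := PUnit
  fintype := inferInstance
  C _ := K
  n _ := 0
  w _ := 1
  isClosed _ := hK
  subset _ := subset_rfl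
  fat _ := ⟨univ, isOpen_univ, by simpa, by simp⟩
  sum_w := by simp
  w_le _ := by simp
  lt_bowenDist i j h := absurd (Subsingleton.elim i j) h

variable [MeasurableSpace X]

/-- The probability measures that give each piece at least its prescribed mass. -/
def measures (S : MassScheme T K s r) : Set (ProbabilityMeasure X) :=
  {μ | ∀ i, S.w i ≤ (μ : Measure X) (S.C i)}

theorem measures_nonempty (S : MassScheme T K s r) : S.measures.Nonempty := by
  have hne (i : S.ι) : (S.C i).Nonempty := by
    obtain ⟨V, -, hV, hVC⟩ := S.fat i
    exact hV.mono hVC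
  choose x hx using hne
  have hprob : IsProbabilityMeasure (∑ i, S.w i • Measure.dirac (x i)) :=
    ⟨by simp [S.sum_w]⟩
  refine ⟨⟨_, hprob⟩, fun i => ?_⟩
  change S.w i ≤ (∑ j, S.w j • Measure.dirac (x j)) (S.C i)
  rw [Measure.finsetSum_apply]
  refine le_trans ?_ (Finset.single_le_sum
    (f := fun j => (S.w j • Measure.dirac (x j)) (S.C i)) (fun _ _ => bot_le) (Finset.mem_univ i))
  simp [hx i]

variable [BorelSpace X]

theorem isClosed_measures (S : MassScheme T K s r) : IsClosed S.measures := by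
  refine isClosed_iff_forall_filter.2 fun μ F hF hFS hFμ i => ?_
  refine le_trans ?_ (ProbabilityMeasure.limsup_measure_closed_le_of_tendsto
    (μs := fun ν : ProbabilityMeasure X => ν) (tendsto_id'.2 hFμ) (S.isClosed i))
  refine le_limsup_of_frequently_le (Eventually.frequently ?_) (by isBoundedDefault)
  filter_upwards [le_principal_iff.1 hFS] with ν hν using hν i

theorem measure_iUnion_eq_one (S : MassScheme T K s r) (hr : 0 ≤ r) {μ : ProbabilityMeasure X}
    (hμ : μ ∈ S.measures) : (μ : Measure X) (⋃ i, S.C i) = 1 := by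
  refine le_antisymm prob_le_one ?_
  rw [measure_iUnion (fun i j h => S.disjoint hr h) fun i => (S.isClosed i).measurableSet,
    tsum_fintype, ← S.sum_w]
  exact Finset.sum_le_sum fun i _ => hμ i

theorem measure_bowenClosedBall_le (S : MassScheme T K s r) (hr : 0 ≤ r)
    {μ : ProbabilityMeasure X} (hμ : μ ∈ S.measures) {i : S.ι} {x : X} (hx : x ∈ S.C i) :
    (μ : Measure X) (bowenClosedBall T (S.n i) x r) ≤
      ENNReal.ofReal (Real.exp (-(S.n i * s))) := by
  classical
  refine le_trans ?_ (S.w_le i)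
  set J := Finset.univ.erase i
  have hJ (j) (hj : j ∈ J) : i ≠ j := (Finset.ne_of_mem_erase hj).symm
  have hdisj : Disjoint (bowenClosedBall T (S.n i) x r) (⋃ j ∈ J, S.C j) := by
    refine disjoint_left.2 fun y hy hy' => ?_
    obtain ⟨j, hj, hyj⟩ := mem_iUnion₂.1 hy'
    exact (S.lt_bowenDist i j (hJ j hj) x hx y hyj).not_ge hy
  have hle : (μ : Measure X) (bowenClosedBall T (S.n i) x r) + ∑ j ∈ J, S.w j ≤
      S.w i + ∑ j ∈ J, S.w j := by
    calc _ ≤ (μ : Measure X) (bowenClosedBall T (S.n i) x r) +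
          ∑ j ∈ J, (μ : Measure X) (S.C j) := by
          gcongr with j hj
          exact hμ j
      _ = (μ : Measure X) (bowenClosedBall T (S.n i) x r ∪ ⋃ j ∈ J, S.C j) := by
          rw [← measure_biUnion_finset (fun j _ k _ h => S.disjoint hr h)
            fun j _ => (S.isClosed j).measurableSet]
          exact (measure_union hdisj (J.measurableSet_biUnion
            fun j _ => (S.isClosed j).measurableSet)).symm
      _ ≤ 1 := prob_le_one
      _ = _ := by rw [← S.sum_w, Finset.add_sum_erase _ _ (Finset.mem_univ i)]
  refine (ENNReal.add_le_add_iff_right ?_).1 hle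
  refine ((Finset.sum_le_sum_of_subset (Finset.erase_subset _ _)).trans_lt ?_).ne
  rw [S.sum_w]
  exact ENNReal.one_lt_top

/-- Every piece is replaced by small neighbourhoods of the points of a large separated set of a
higher order, which share its mass equally. Since the order increases, a ball around a point of a
new piece still avoids the pieces that come from other old ones. -/
theorem exists_refinement [CompactSpace X] (hT : Continuous T) {ε : ℝ} (hε : 0 < ε)
    (hK : IsClosed K)
    (hsep : ∀ V, IsOpen V → (V ∩ K).Nonempty → ∀ N : ℕ, ∃ n ≥ N, ∃ E : Finset X,
      (E : Set X) ⊆ V ∩ K ∧ (∀ x ∈ E, ∀ y ∈ E, x ≠ y → 2 * ε < bowenDist T n x y) ∧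
        Real.exp (n * s) ≤ E.card)
    (S : MassScheme T K s ε) (N : ℕ) :
    ∃ S' : MassScheme T K s ε, (∀ i, N ≤ S'.n i) ∧ S'.measures ⊆ S.measures := by
  classical
  choose V hVo hVne hVC using S.fat
  choose n hn E hEV hEsep hEcard using fun i => hsep (V i) (hVo i) (hVne i) (max N (S.n i))
  have hnbhd (i) (x : E i) : ∃ D : Set X, D ∈ 𝓝 x.1 ∧ IsClosed D ∧
      D ⊆ V i ∩ bowenBall T (n i) x (ε / 2) :=
    exists_mem_nhds_isClosed_subset (((hVo i).inter (isOpen_bowenBall hT (half_pos hε))).mem_nhds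
      ⟨(hEV i x.2).1, mem_bowenBall_self (half_pos hε)⟩)
  choose D hDx hDc hD using hnbhd
  have hsub (i) (x : E i) : D i x ∩ K ⊆ S.C i := fun y hy => hVC i ⟨(hD i x hy.1).1, hy.2⟩
  have hcard0 (i) : 0 < ((E i).card : ℝ) := (Real.exp_pos _).trans_le (hEcard i)
  have hcard (i) : ((E i).card : ℝ≥0∞) ≠ 0 := by
    have := hcard0 i
    exact_mod_cast this.ne'
  have hshare (i) : ∑ _x : E i, S.w i / (E i).card = S.w i := by
    rw [Finset.sum_const, Finset.card_univ, Fintype.card_coe, nsmul_eq_mul,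
      ENNReal.mul_div_cancel (hcard i) (ENNReal.natCast_ne_top _)]
  let S' : MassScheme T K s ε :=
    { ι := Σ i, E i
      fintype := inferInstance
      C := fun p => D p.1 p.2 ∩ K
      n := fun p => n p.1
      w := fun p => S.w p.1 / (E p.1).card
      isClosed := fun p => (hDc p.1 p.2).inter hK
      subset := fun p => inter_subset_right
      fat := fun p => ⟨interior (D p.1 p.2), isOpen_interior,
        ⟨p.2, mem_interior_iff_mem_nhds.2 (hDx p.1 p.2), (hEV p.1 p.2.2).2⟩,
        inter_subset_inter_left _ interior_subset⟩
      sum_w := by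
        rw [Fintype.sum_sigma]
        simp_rw [hshare, S.sum_w]
      w_le := fun p => by
        rw [Real.exp_neg, ENNReal.ofReal_inv_of_pos (Real.exp_pos _), ← one_div]
        refine ENNReal.div_le_div (S.w_le_one _) ?_
        rw [← ENNReal.ofReal_natCast]
        exact ENNReal.ofReal_le_ofReal (hEcard p.1)
      lt_bowenDist := by
        rintro ⟨i, x⟩ ⟨j, y⟩ hne z hz z' hz'
        dsimp only at hz hz' ⊢
        by_cases hij : i = j
        · subst hij
          have hxy : (x : X) ≠ y := fun h => hne (by rw [Subtype.ext h])
          have h1 := hEsep i x x.2 y y.2 hxy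
          have h2 := mem_bowenBall.1 (hD i x hz.1).2
          have h3 := mem_bowenBall.1 (hD i y hz'.1).2
          have h4 := bowenDist_triangle (T := T) (n i) x z y
          have h5 := bowenDist_triangle (T := T) (n i) z z' y
          rw [bowenDist_comm _ z'] at h5
          linarith
        · exact (S.lt_bowenDist i j hij z (hsub i x hz) z' (hsub j y hz')).trans_le
            (bowenDist_mono ((le_max_right _ _).trans (hn i)) z z') }
  refine ⟨S', fun p => (le_max_left _ _).trans (hn p.1), fun μ hμ i => ?_⟩
  calc S.w i = ∑ x : E i, S'.w ⟨i, x⟩ := (hshare i).symm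
    _ ≤ ∑ x : E i, (μ : Measure X) (S'.C ⟨i, x⟩) := Finset.sum_le_sum fun x _ => hμ ⟨i, x⟩
    _ = (μ : Measure X) (⋃ x : E i, S'.C ⟨i, x⟩) := by
      rw [measure_iUnion
        (fun x y h => S'.disjoint hε.le fun h' => h (eq_of_heq (Sigma.mk.inj_iff.1 h').2))
        fun x => (S'.isClosed _).measurableSet, tsum_fintype]
    _ ≤ _ := measure_mono (iUnion_subset fun x => hsub i x)

end MassScheme

/-- If every nonempty relatively open subset of `K` contains large separated sets of arbitrarily
large order, some probability measure on `K` has, around almost every point, closed Bowen balls of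
arbitrarily large order `n` with mass at most `e ^ (-n s)`. By compactness, successive refinements
of mass schemes have a common compatible measure. -/
theorem exists_measure_small_balls [CompactSpace X] [MeasurableSpace X] [BorelSpace X] {T : X → X}
    (hT : Continuous T) {K : Set X} (hK : IsClosed K) (hne : K.Nonempty) {s ε : ℝ}
    (hε : 0 < ε)
    (hsep : ∀ V, IsOpen V → (V ∩ K).Nonempty → ∀ N : ℕ, ∃ n ≥ N, ∃ E : Finset X,
      (E : Set X) ⊆ V ∩ K ∧ (∀ x ∈ E, ∀ y ∈ E, x ≠ y → 2 * ε < bowenDist T n x y) ∧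
        Real.exp (n * s) ≤ E.card) :
    ∃ μ : ProbabilityMeasure X, (μ : Measure X) K = 1 ∧ ∀ᵐ x ∂(μ : Measure X), ∀ N : ℕ, ∃ n ≥ N,
      (μ : Measure X) (bowenClosedBall T n x ε) ≤ ENNReal.ofReal (Real.exp (-(n * s))) := by
  choose next hnextN hnext using MassScheme.exists_refinement hT hε hK hsep
  let S : ℕ → MassScheme T K s ε :=
    fun k => Nat.rec (MassScheme.single hK hne) (fun k S => next S k) k
  obtain ⟨μ, hμ⟩ : (⋂ k, (S k).measures).Nonempty :=
    IsCompact.nonempty_iInter_of_sequence_nonempty_isCompact_isClosed _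
      (fun k => hnext (S k) k) (fun k => (S k).measures_nonempty)
      (S 0).isClosed_measures.isCompact fun k => (S k).isClosed_measures
  rw [mem_iInter] at hμ
  refine ⟨μ, ?_, ?_⟩
  · have := (S 0).measure_iUnion_eq_one hε.le (hμ 0)
    exact le_antisymm prob_le_one (this.symm.le.trans
      (measure_mono (iUnion_subset fun i => (S 0).subset i)))
  · refine ae_all_iff.2 fun N => ?_
    have h1 : ∀ᵐ x ∂(μ : Measure X), x ∈ ⋃ i, (S (N + 1)).C i :=
      (mem_ae_iff_prob_eq_one (MeasurableSet.iUnion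
        fun i => ((S (N + 1)).isClosed i).measurableSet)).2
        ((S (N + 1)).measure_iUnion_eq_one hε.le (hμ (N + 1)))
    filter_upwards [h1] with x hx
    obtain ⟨i, hi⟩ := mem_iUnion.1 hx
    exact ⟨_, hnextN (S N) N i, (S (N + 1)).measure_bowenClosedBall_le hε.le (hμ (N + 1)) hi⟩

end MassScheme

/-! ### The packing variational inequality -/

section PackingVariational

variable {X : Type*} [MetricSpace X] [CompactSpace X] [MeasurableSpace X] {T : X → X}

/-- Vitali covering: the points of `W` at which `μ` has small balls of arbitrarily large order are
covered by the doubles of a disjoint family of such balls. -/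
theorem measure_inter_le_packP (hT : Continuous T) (μ : Measure X) {s : ℝ≥0} {ε : ℝ} (hε : 0 < ε)
    (W : Set X) :
    μ (W ∩ {x | ∀ N : ℕ, ∃ n ≥ N, μ (bowenClosedBall T n x (2 * ε)) ≤
      ENNReal.ofReal (Real.exp (-(n * s)))}) ≤ packP T W s ε := by
  refine le_iInf fun N => ?_
  let t : Set (ℕ × X) := {p | N ≤ p.1 ∧ p.2 ∈ W ∧
    μ (bowenClosedBall T p.1 p.2 (2 * ε)) ≤ ENNReal.ofReal (Real.exp (-(p.1 * s)))}
  obtain ⟨u, hut, hu, hcov⟩ := Vitali.exists_disjoint_subfamily_covering_enlargement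
    (fun p : ℕ × X => bowenClosedBall T p.1 p.2 ε) t (fun p => (1 / 2) ^ p.1) (3 / 2) (by norm_num)
    (fun p _ => by positivity) 1 (fun p _ => pow_le_one₀ (by norm_num) (by norm_num))
    fun p _ => ⟨p.2, by simpa [mem_bowenClosedBall] using hε.le⟩
  have huc := countable_of_pairwiseDisjoint_bowenClosedBall hT hε hu
  have hsub : W ∩ {x | ∀ N : ℕ, ∃ n ≥ N, μ (bowenClosedBall T n x (2 * ε)) ≤
      ENNReal.ofReal (Real.exp (-(n * s)))} ⊆ ⋃ p ∈ u, bowenClosedBall T p.1 p.2 (2 * ε) := by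
    rintro x ⟨hxW, hx⟩
    obtain ⟨n, hn, hnx⟩ := hx N
    obtain ⟨p, hp, ⟨y, hy, hy'⟩, hle⟩ := hcov (n, x) ⟨hn, hxW, hnx⟩
    dsimp only at hy hy' hle
    -- with sizes `2 ^ (-n)`, the factor `3 / 2 < 2` forces the order of the covering ball to be
    -- at most `n`
    have hpn : p.1 ≤ n := by
      by_contra hlt
      have h1 : (1 / 2 : ℝ) ^ p.1 ≤ (1 / 2) ^ (n + 1) :=
        pow_le_pow_of_le_one (by norm_num) (by norm_num) (by omega)
      rw [pow_succ] at h1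
      have h2 : (0 : ℝ) < (1 / 2) ^ n := by positivity
      linarith
    have h1 := mem_bowenClosedBall.1 hy
    have h2 := mem_bowenClosedBall.1 hy'
    have h3 := bowenDist_triangle (T := T) p.1 p.2 y x
    have h4 := bowenDist_mono (T := T) hpn x y
    rw [bowenDist_comm _ y] at h3
    exact mem_biUnion hp (mem_bowenClosedBall.2 (by linarith))
  calc _ ≤ μ (⋃ p ∈ u, bowenClosedBall T p.1 p.2 (2 * ε)) := measure_mono hsub
    _ ≤ ∑' p : u, μ (bowenClosedBall T p.1.1 p.1.2 (2 * ε)) := measure_biUnion_le μ huc _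
    _ ≤ weight s u := ENNReal.tsum_le_tsum fun p => (hut p.2).2.2
    _ ≤ packPN T W s N ε := le_iSup_of_le u (le_iSup_of_le huc (le_iSup_of_le
        (fun p hp => ⟨(hut hp).1, (hut hp).2.1⟩) (le_iSup_of_le hu le_rfl)))

theorem le_packKatokEntropy_of_small_balls (hT : Continuous T) {μ : Measure X} {s : ℝ≥0} {ε : ℝ}
    (hε : 0 < ε) (hμ : ∀ᵐ x ∂μ, ∀ N : ℕ, ∃ n ≥ N, μ (bowenClosedBall T n x (2 * ε)) ≤
      ENNReal.ofReal (Real.exp (-(n * s)))) : (s : ℝ≥0∞) ≤ packKatokEntropy T μ ε := by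
  have hδ : (1 / 2 : ℝ) ∈ Ioo (0 : ℝ) 1 := by norm_num
  refine le_trans ?_ (le_iSup₂
    (f := fun δ (_ : δ ∈ Ioo (0 : ℝ) 1) => packKatokEntropyDelta T μ δ ε) _ hδ)
  refine le_iInf_of_ne_zero (packKatokP_anti μ _ ε) fun h0 => ?_
  have h1 : ENNReal.ofReal (1 - 1 / 2) ≤ packKatokP T μ (1 / 2) s ε := by
    refine le_iInf₂ fun W hW => hW.le.trans ?_
    refine (measure_iUnion_le W).trans (ENNReal.tsum_le_tsum fun i => ?_)
    refine le_trans (measure_mono_ae ?_) (measure_inter_le_packP hT μ (s := s) hε (W i))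
    filter_upwards [hμ] with x hx hxW using ⟨hxW, hx⟩
  rw [h0] at h1
  norm_num at h1

theorem packEntropy_le_iSup_packKatokEntropy [BorelSpace X] (hT : Continuous T) {K : Set X}
    (hK : IsCompact K) {ε : ℝ} (hε : 0 < ε) :
    packEntropy T K (4 * ε) ≤
      ⨆ (μ : ProbabilityMeasure X) (_ : (μ : Measure X) K = 1),
        packKatokEntropy T (μ : Measure X) ε := by
  refine le_of_forall_lt fun b hb => ?_
  obtain ⟨s, hbs, hs⟩ := ENNReal.lt_iff_exists_nnreal_btwn.1 hb
  obtain ⟨t, hst, ht⟩ := ENNReal.lt_iff_exists_nnreal_btwn.1 hs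
  obtain ⟨K', hK'K, hK', hne, hpos⟩ := exists_isCompact_forall_packOuter_ne_zero hK
    (ne_zero_of_lt_iInf (f := fun t => packOuter T K t (4 * ε)) ht)
  have h4 : 2 * (2 * ε) = 4 * ε := by ring
  obtain ⟨μ, hμK', hμ⟩ := exists_measure_small_balls (ε := 2 * ε) (s := s) hT hK'.isClosed hne
    (by positivity) fun V hV hVK N => by
      rw [h4]
      refine exists_separated_of_packP_ne_zero (ENNReal.coe_lt_coe.1 hst) (by positivity)
        (fun h0 => hpos V hV hVK ?_) N
      exact le_antisymm ((packOuter_le_packP _ _ _).trans h0.le) bot_le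
  have hμK : (μ : Measure X) K = 1 :=
    le_antisymm prob_le_one (hμK'.symm.le.trans (measure_mono hK'K))
  exact hbs.trans_le ((le_packKatokEntropy_of_small_balls hT hε hμ).trans
    (le_iSup₂ (f := fun (μ : ProbabilityMeasure X) (_ : (μ : Measure X) K = 1) =>
      packKatokEntropy T (μ : Measure X) ε) μ hμK))

end PackingVariational

end MetricMeanDim

theorem mainTheorem4 {X : Type*} [MetricSpace X] [CompactSpace X] [MeasurableSpace X]
    [BorelSpace X] (T : X ≃ₜ X) (K : Set X) (hK : IsCompact K) (hne : K.Nonempty) :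
    MetricMeanDim.bowenUpperMdim T K =
        limsup (fun ε : ℝ =>
          (⨆ (μ : ProbabilityMeasure X) (_ : (μ : Measure X) K = 1),
            MetricMeanDim.katokEntropy T (μ : Measure X) ε) /
          ENNReal.ofReal (Real.log (1 / ε))) (𝓝[>] 0) ∧
      MetricMeanDim.packUpperMdim T K =
        limsup (fun ε : ℝ =>
          (⨆ (μ : ProbabilityMeasure X) (_ : (μ : Measure X) K = 1),
            MetricMeanDim.packKatokEntropy T (μ : Measure X) ε) /
          ENNReal.ofReal (Real.log (1 / ε))) (𝓝[>] 0) := by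
  refine ⟨?_, ?_⟩
  · exact MetricMeanDim.limsup_div_log_eq two_pos
      (fun ε => iSup₂_le fun μ hμ => MetricMeanDim.katokEntropy_le_bowenEntropy hμ ε)
      fun ε hε => MetricMeanDim.bowenEntropy_le_iSup_katokEntropy T.continuous hK hε
  · exact MetricMeanDim.limsup_div_log_eq four_pos
      (fun ε => iSup₂_le fun μ hμ => MetricMeanDim.packKatokEntropy_le_packEntropy hμ ε)
      fun ε hε => MetricMeanDim.packEntropy_le_iSup_packKatokEntropy T.continuous hK hε
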